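/- Let $M>0$ and consider the Schwarzschild exterior $t\in\mathbb R$, $r>2M$, $\omega\in S^2$ with metric $g=-(1-\frac{2M}{r})dt^2+(1-\frac{2M}{r})^{-1}dr^2+r^2\mathring\sigma$, where $\mathring\sigma$ is the round metric of the unit sphere, with connection $\mathring\nabla$ and Laplacian $\mathring\Delta$. Let $x^A$ ($A=0,1$) denote $(t,r)$ and $x^\alpha$ coordinates on $S^2$. A symmetric two-tensor is of closed form if $$h=h_{AB}dx^Adx^B+2(\mathring\nabla_\alpha H_A)dx^\alpha dx^A+\big(H\mathring\sigma_{\alpha\beta}+\mathring\nabla_\alpha\mathring\nabla_\beta H_2-\tfrac12\mathring\sigma_{\alpha\beta}\mathring\Delta H_2\big)dx^\alpha dx^\beta$$ for smooth functions $h_{AB},H_A,H,H_2$ on the exterior; a covector is of closed form if $X=G_Adx^A+(\mathring\nabla_\alpha G_2)dx^\alpha$ with $G_A,G_2$ smooth, and $\pi_X=\mathcal L_Xg$ is its deformation tensor. A closed tensor $h$ is in Chandrasekhar gauge if $h_{01}=0$, $H_0=H_1=0$, and $\frac12\mathring\Delta H_2+H_2-H-(r^2-2Mr)h_{11}=0$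 at $t=0$. Let $2M<r_0<R_0<\infty$, and let $h^*$ be a smooth tensor of closed form which solves the linearized vacuum Einstein equations $\delta G|_g(h^*)=0$ on the exterior and is supported in $r_0<r<R_0$ on the slice $\{t=0\}$. Let $h$ be either - a normalization $h_{\mathrm I}=h^*-\pi_{X_{\mathrm I}}$, with $X_{\mathrm I}$ of closed form, in Chandrasekhar gauge and supported away from the bifurcation sphere, in $r_0<r<\infty$, on $\{t=0\}$; or - a normalization $h_{\mathrm{II}}=h^*-\pi_{X_{\mathrm{II}}}$, with $X_{\mathrm{II}}$ of closed form, in Chandrasekhar gauge and supported away from spatial infinity, in $2M<r<R_0$, on $\{t=0\}$. Let $\ell\ge2$, let $Y$ be a real spherical harmonic of degree $\ell$ ($\mathring\Delta Y=-\ell(\ell+1)Y$), and let $\tilde h_{11},\tilde H,\tilde H_2$ be the functions of $(t,r)$ obtained by integrating $h_{11},H,H_2$ against $Y$ over $S^2$. Then the Friedman variables $$L=\tfrac12\Big(1-\frac{2M}{r}\Big)\tilde h_{11},\qquad T=\frac{1}{2r^2}\tilde H,\qquad V=\frac1{2r^2}\tilde H_2$$ satisfy, for all $t\in\mathbb R$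 and $r>2M$, $$L+\tfrac12(\ell+2)(\ell-1)V+T=0,$$ $$T_r=-\frac{(\ell+2)(\ell-1)}{2r}V-\frac{2r-5M}{r(r-2M)}T.$$ -/

import Mathlib

open scoped Manifold ContDiff

namespace Schwarzschild

noncomputable section

/-! ### The exterior region and its standard coordinates

Points of the coordinate domain are `x : Fin 4 → ℝ` with `x 0 = t`, `x 1 = r`, `x 2 = θ`,
`x 3 = φ`. -/

/-- The standard coordinate domain of the exterior of mass `M`: `r > 2M`, `0 < θ < π`. -/
def exterior (M : ℝ) : Set (Fin 4 → ℝ) :=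
  {x | 2 * M < x 1 ∧ 0 < x 2 ∧ x 2 < Real.pi}

/-- The coordinate derivative `∂ₐ f`. -/
def pd (a : Fin 4) (f : (Fin 4 → ℝ) → ℝ) (x : Fin 4 → ℝ) : ℝ :=
  fderiv ℝ f x (Pi.single a 1)

/-- The Schwarzschild metric
`-(1 - 2M/r) dt² + (1 - 2M/r)⁻¹ dr² + r² (dθ² + sin² θ dφ²)`. -/
def metric (M : ℝ) (x : Fin 4 → ℝ) : Matrix (Fin 4) (Fin 4) ℝ :=
  Matrix.diagonal
    ![-(1 - 2 * M / x 1), (1 - 2 * M / x 1)⁻¹, x 1 ^ 2, x 1 ^ 2 * Real.sin (x 2) ^ 2]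

/-- The Christoffel symbols `Γᶜₐᵦ` of the Schwarzschild metric. -/
def christoffel (M : ℝ) (c a b : Fin 4) (x : Fin 4 → ℝ) : ℝ :=
  (1 / 2) * ∑ d, (metric M x)⁻¹ c d *
    (pd a (fun y => metric M y b d) x + pd b (fun y => metric M y a d) x
      - pd d (fun y => metric M y a b) x)

/-- The covariant derivative `∇ₐ X_b` of a covector field. -/
def cov₁ (M : ℝ) (X : Fin 4 → (Fin 4 → ℝ) → ℝ) (a b : Fin 4) (x : Fin 4 → ℝ) : ℝ :=
  pd a (X b) x - ∑ e, christoffel M e a b x * X e x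

/-- The covariant derivative `∇ₐ h_bc` of a covariant two-tensor field. -/
def cov₂ (M : ℝ) (h : Fin 4 → Fin 4 → (Fin 4 → ℝ) → ℝ) (a b c : Fin 4) (x : Fin 4 → ℝ) : ℝ :=
  pd a (h b c) x - ∑ e, christoffel M e a b x * h e c x - ∑ e, christoffel M e a c x * h b e x

/-- The covariant derivative `∇ₐ k_bcd` of a covariant three-tensor field. -/
def cov₃ (M : ℝ) (k : Fin 4 → Fin 4 → Fin 4 → (Fin 4 → ℝ) → ℝ) (a b c d : Fin 4)
    (x : Fin 4 → ℝ) : ℝ :=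
  pd a (k b c d) x - ∑ e, christoffel M e a b x * k e c d x
    - ∑ e, christoffel M e a c x * k b e d x - ∑ e, christoffel M e a d x * k b c e x

/-- The second covariant derivative `∇ₐ ∇_b h_cd`. -/
def covCov (M : ℝ) (h : Fin 4 → Fin 4 → (Fin 4 → ℝ) → ℝ) (a b c d : Fin 4) (x : Fin 4 → ℝ) : ℝ :=
  cov₃ M (cov₂ M h) a b c d x

/-- The linearized Ricci tensor,
`2 δR_bd = gᵃᵉ (∇ₐ∇_d h_eb + ∇ₐ∇_b h_ed - ∇_d∇_b h_ea - ∇ₐ∇ₑ h_bd)`. -/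
def linRicci (M : ℝ) (h : Fin 4 → Fin 4 → (Fin 4 → ℝ) → ℝ) (b d : Fin 4) (x : Fin 4 → ℝ) : ℝ :=
  (1 / 2) * ∑ a, ∑ e, (metric M x)⁻¹ a e *
    (covCov M h a d e b x + covCov M h a b e d x - covCov M h d b e a x - covCov M h a e b d x)

/-- The linearized Einstein tensor at the (Ricci-flat) Schwarzschild metric,
`δG_ab = δR_ab - ½ g_ab gᶜᵈ δR_cd`. -/
def linEinstein (M : ℝ) (h : Fin 4 → Fin 4 → (Fin 4 → ℝ) → ℝ) (a b : Fin 4)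
    (x : Fin 4 → ℝ) : ℝ :=
  linRicci M h a b x
    - (1 / 2) * metric M x a b * ∑ c, ∑ d, (metric M x)⁻¹ c d * linRicci M h c d x

/-- `h` solves the linearized vacuum Einstein equations on the exterior. -/
def SolvesLinearizedEinstein (M : ℝ) (h : Fin 4 → Fin 4 → (Fin 4 → ℝ) → ℝ) : Prop :=
  ∀ x ∈ exterior M, ∀ a b, linEinstein M h a b x = 0

/-- The deformation tensor `π_X = ∇ₐ X_b + ∇_b X_a` (the Lie derivative of the metric). -/
def deformation (M : ℝ) (X : Fin 4 → (Fin 4 → ℝ) → ℝ) (a b : Fin 4) (x : Fin 4 → ℝ) : ℝ :=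
  cov₁ M X a b x + cov₁ M X b a x

/-! ### Functions on the exterior, seen as the product of the `(t, r)` quotient and the sphere -/

/-- The unit sphere in `ℝ³`. -/
abbrev S2 : Type := Metric.sphere (0 : EuclideanSpace ℝ (Fin 3)) 1

/-- The point of the unit sphere with spherical coordinates `(θ, φ)`. -/
def sphPt (θ φ : ℝ) : S2 :=
  ⟨!₂[Real.sin θ * Real.cos φ, Real.sin θ * Real.sin φ, Real.cos θ], by
    rw [mem_sphere_zero_iff_norm, EuclideanSpace.norm_eq, Real.sqrt_eq_one]
    simp only [Real.norm_eq_abs, sq_abs, Fin.sum_univ_three]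
    simp
    nlinarith [Real.sin_sq_add_cos_sq θ, Real.sin_sq_add_cos_sq φ]⟩

/-- A function of `((t, r), ω)`, with `ω` in the unit sphere. -/
abbrev Fld : Type := (ℝ × ℝ) × S2 → ℝ

/-- Smoothness on `{r > 2M}`, including the poles of the spheres. -/
def SmoothFld (M : ℝ) (f : Fld) : Prop :=
  ContMDiffOn (𝓘(ℝ, ℝ × ℝ).prod (𝓡 2)) 𝓘(ℝ, ℝ) ∞ f {p | 2 * M < p.1.2}

/-- The coordinate expression of a function in `(t, r, θ, φ)`. -/
def Fld.pull (f : Fld) (x : Fin 4 → ℝ) : ℝ := f ((x 0, x 1), sphPt (x 2) (x 3))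

/-- The `θθ` component of the Hessian `∇̊_α ∇̊_β f = ∂_α ∂_β f - Γ̊^γ_αβ ∂_γ f` of the round unit
sphere. -/
def hessθθ (f : (Fin 4 → ℝ) → ℝ) (x : Fin 4 → ℝ) : ℝ := pd 2 (pd 2 f) x

/-- The `θφ` component of the spherical Hessian. -/
def hessθφ (f : (Fin 4 → ℝ) → ℝ) (x : Fin 4 → ℝ) : ℝ :=
  pd 2 (pd 3 f) x - Real.cos (x 2) / Real.sin (x 2) * pd 3 f x

/-- The `φφ` component of the spherical Hessian. -/
def hessφφ (f : (Fin 4 → ℝ) → ℝ) (x : Fin 4 → ℝ) : ℝ :=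
  pd 3 (pd 3 f) x + Real.sin (x 2) * Real.cos (x 2) * pd 2 f x

/-- The Laplacian of the round unit sphere, the trace of the Hessian. -/
def sphLap (f : (Fin 4 → ℝ) → ℝ) (x : Fin 4 → ℝ) : ℝ :=
  hessθθ f x + hessφφ f x / Real.sin (x 2) ^ 2

/-! ### Closed tensors and covectors -/

/-- The coefficient functions of a symmetric two-tensor of closed form. -/
structure ClosedTensor where
  (h00 h01 h11 H0 H1 H H2 : Fld)

namespace ClosedTensor

/-- All coefficient functions are smooth on the exterior. -/
def Smooth (M : ℝ) (h : ClosedTensor) : Prop :=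
  SmoothFld M h.h00 ∧ SmoothFld M h.h01 ∧ SmoothFld M h.h11 ∧ SmoothFld M h.H0 ∧
    SmoothFld M h.H1 ∧ SmoothFld M h.H ∧ SmoothFld M h.H2

/-- The components of the closed two-tensor
`h_AB dx^A dx^B + 2 (∇̊_α H_A) dx^α dx^A + (H σ̊_αβ + ∇̊_α∇̊_β H₂ - ½ σ̊_αβ Δ̊H₂) dx^α dx^β`. -/
def toTensor (h : ClosedTensor) (a b : Fin 4) (x : Fin 4 → ℝ) : ℝ :=
  (!![h.h00.pull x, h.h01.pull x, pd 2 h.H0.pull x, pd 3 h.H0.pull x;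
      h.h01.pull x, h.h11.pull x, pd 2 h.H1.pull x, pd 3 h.H1.pull x;
      pd 2 h.H0.pull x, pd 2 h.H1.pull x,
        h.H.pull x + hessθθ h.H2.pull x - (1 / 2) * sphLap h.H2.pull x,
        hessθφ h.H2.pull x;
      pd 3 h.H0.pull x, pd 3 h.H1.pull x,
        hessθφ h.H2.pull x,
        Real.sin (x 2) ^ 2 * h.H.pull x + hessφφ h.H2.pull x
          - (1 / 2) * Real.sin (x 2) ^ 2 * sphLap h.H2.pull x] :
    Matrix (Fin 4) (Fin 4) ℝ) a b

/-- The constraint operator `𝓛(h) = ½ Δ̊H₂ + H₂ - H - (r² - 2Mr) h₁₁`. -/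
def constraint (M : ℝ) (h : ClosedTensor) (x : Fin 4 → ℝ) : ℝ :=
  (1 / 2) * sphLap h.H2.pull x + h.H2.pull x - h.H.pull x
    - (x 1 ^ 2 - 2 * M * x 1) * h.h11.pull x

/-- The Chandrasekhar gauge: `h₀₁ = 0`, `H_A = 0`, and `𝓛(h) = 0` at `t = 0`. -/
def InChandrasekharGauge (M : ℝ) (h : ClosedTensor) : Prop :=
  (∀ p : (ℝ × ℝ) × S2, 2 * M < p.1.2 → h.h01 p = 0 ∧ h.H0 p = 0 ∧ h.H1 p = 0) ∧
    ∀ x ∈ exterior M, x 0 = 0 → h.constraint M x = 0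

end ClosedTensor

/-- The coefficient functions of a covector of closed form. -/
structure ClosedCovector where
  (G0 G1 G2 : Fld)

namespace ClosedCovector

/-- All coefficient functions are smooth on the exterior. -/
def Smooth (M : ℝ) (X : ClosedCovector) : Prop :=
  SmoothFld M X.G0 ∧ SmoothFld M X.G1 ∧ SmoothFld M X.G2

/-- The components of the closed covector `G_A dx^A + (∇̊_α G₂) dx^α`. -/
def toCovector (X : ClosedCovector) (a : Fin 4) (x : Fin 4 → ℝ) : ℝ :=
  ![X.G0.pull x, X.G1.pull x, pd 2 X.G2.pull x, pd 3 X.G2.pull x] a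

end ClosedCovector

/-- On the slice `t = 0` the tensor `h` vanishes at all radii `r > 2M` outside the set `I`. -/
def SupportedInitially (M : ℝ) (h : Fin 4 → Fin 4 → (Fin 4 → ℝ) → ℝ) (I : Set ℝ) : Prop :=
  ∀ x ∈ exterior M, x 0 = 0 → x 1 ∉ I → ∀ a b, h a b x = 0

/-- `h` is a normalization of `k` with initial support in the radial set `I`: it is of closed form
and in Chandrasekhar gauge, `h = k - π_X` for a smooth closed covector `X`, and on `t = 0` it is
supported in radii `r ∈ I`. -/
structure IsNormalization (M : ℝ) (I : Set ℝ) (k : ClosedTensor) (X : ClosedCovector)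
    (h : ClosedTensor) : Prop where
  smooth_covector : X.Smooth M
  smooth : h.Smooth M
  eq_sub : ∀ x ∈ exterior M, ∀ a b,
    h.toTensor a b x = k.toTensor a b x - deformation M X.toCovector a b x
  gauge : h.InChandrasekharGauge M
  support : SupportedInitially M h.toTensor I

/-- The normalization `h_I`, supported away from the bifurcation sphere (`r > r₀`) at `t = 0`. -/
def IsNormalizationI (M r₀ : ℝ) (k : ClosedTensor) (X : ClosedCovector) (h : ClosedTensor) :
    Prop :=
  IsNormalization M (Set.Ioi r₀) k X h

/-- The normalization `h_II`, supported away from spatial infinity (`r < R₀`) at `t = 0`. -/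
def IsNormalizationII (M R₀ : ℝ) (k : ClosedTensor) (X : ClosedCovector) (h : ClosedTensor) :
    Prop :=
  IsNormalization M (Set.Iio R₀) k X h

/-! ### Spherical harmonics and the Friedman substitution -/

/-- `Y` is a (real) spherical harmonic of degree `ℓ`: `Δ̊ Y = -ℓ(ℓ+1) Y`. -/
def IsSphericalHarmonic (ℓ : ℕ) (Y : S2 → ℝ) : Prop :=
  ContMDiff (𝓡 2) 𝓘(ℝ, ℝ) ∞ Y ∧
    ∀ x : Fin 4 → ℝ, 0 < x 2 → x 2 < Real.pi →
      sphLap (fun y => Y (sphPt (y 2) (y 3))) x = -(ℓ * (ℓ + 1)) * Y (sphPt (x 2) (x 3))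

/-- The coefficient `∫_{S²} f(t, r, ·) Y` of `f` along the spherical harmonic `Y`, as a function of
`(t, r)`. -/
def mode (Y : S2 → ℝ) (f : Fld) (t r : ℝ) : ℝ :=
  ∫ θ in (0 : ℝ)..Real.pi, ∫ φ in (0 : ℝ)..(2 * Real.pi),
    f ((t, r), sphPt θ φ) * Y (sphPt θ φ) * Real.sin θ

/-- `L = ½ (1 - 2M/r) h₁₁`, projected to `Y`. -/
def friedmanL (M : ℝ) (h : ClosedTensor) (Y : S2 → ℝ) (t r : ℝ) : ℝ :=
  (1 / 2) * (1 - 2 * M / r) * mode Y h.h11 t r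

/-- `T = H / (2 r²)`, projected to `Y`. -/
def friedmanT (h : ClosedTensor) (Y : S2 → ℝ) (t r : ℝ) : ℝ :=
  1 / (2 * r ^ 2) * mode Y h.H t r

/-- `V = H₂ / (2 r²)`, projected to `Y`. -/
def friedmanV (h : ClosedTensor) (Y : S2 → ℝ) (t r : ℝ) : ℝ :=
  1 / (2 * r ^ 2) * mode Y h.H2 t r

/-- The two equations for the Friedman variables of `h` along a spherical harmonic `Y` of
degree `ℓ`, on the whole exterior `t ∈ ℝ`, `r > 2M`. -/
def FriedmanEquations (M : ℝ) (h : ClosedTensor) (ℓ : ℕ) (Y : S2 → ℝ) : Prop :=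
  ∀ t r : ℝ, 2 * M < r →
    friedmanL M h Y t r + (1 / 2) * ((ℓ : ℝ) + 2) * ((ℓ : ℝ) - 1) * friedmanV h Y t r
        + friedmanT h Y t r = 0 ∧
      HasDerivAt (fun s => friedmanT h Y t s)
        (-(((ℓ : ℝ) + 2) * ((ℓ : ℝ) - 1) / (2 * r)) * friedmanV h Y t r
          - (2 * r - 5 * M) / (r * (r - 2 * M)) * friedmanT h Y t r) r

end

end Schwarzschild

/-!
The argument rests on the four constraint components of the linearized Einstein equations relative
to the slices of constant `t`. Deformation tensors satisfy them identically
(`constraintsAt_deformation`, by expanding both sides in jets of the covector), so every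
normalization `h = h* - π_X` satisfies them along with `h*` (`IsNormalization.constraintsAt`).

In Chandrasekhar gauge the components take a simple form. Let `𝓛 = ½ Δ̊H₂ + H₂ - H - (r² - 2Mr) h₁₁`
and let `W` be the quantity `radialConstraint`, an expression in `h₁₁`, `H` and `∂_r H`. Up to
nonzero factors depending on `r`,

* the `tr` component is `∂_t W`,
* the `tθ` and `tφ` components are `∂_t ∂_θ 𝓛` and `∂_t ∂_φ 𝓛`,
* the Hamiltonian constraint is `4 r² ∂_r W + Δ̊𝓛`.

As `𝓛 = 0` at `t = 0`, the second item shows that `𝓛` is constant on every sphere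
(`IsNormalization.constraint_const`). At `t = 0` the third one shows that `W` does not depend on
`r`; as `W` vanishes at radii outside the support, whether towards the horizon or towards
infinity, it vanishes at `t = 0`, and hence everywhere by the first item
(`IsNormalization.radialConstraint_eq_zero`).

The first Friedman equation is the projection to `Y` of the statement on `𝓛`: by Green's identity
(`integral_green`) `Δ̊` turns into `-ℓ(ℓ+1)`, and the constant drops out because `Y` has mean zero.
The second one is the projection of `W = 0`, combined with the first.
-/

namespace Schwarzschild

noncomputable section

/-! ### Calculus of coordinate derivatives on the exterior -/

/-- Smoothness of a coordinate function on the exterior. -/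
def SmoothExt (M : ℝ) (f : (Fin 4 → ℝ) → ℝ) : Prop := ContDiffOn ℝ ∞ f (exterior M)

theorem isOpen_exterior (M : ℝ) : IsOpen (exterior M) :=
  (isOpen_lt continuous_const (continuous_apply 1)).inter
    ((isOpen_lt continuous_const (continuous_apply 2)).inter
      (isOpen_lt (continuous_apply 2) continuous_const))

variable {M : ℝ} {f g : (Fin 4 → ℝ) → ℝ} {x : Fin 4 → ℝ}

theorem SmoothExt.contDiffAt (hf : SmoothExt M f) (hx : x ∈ exterior M) : ContDiffAt ℝ ∞ f x :=
  ContDiffOn.contDiffAt hf ((isOpen_exterior M).mem_nhds hx)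

theorem SmoothExt.differentiableAt (hf : SmoothExt M f) (hx : x ∈ exterior M) :
    DifferentiableAt ℝ f x :=
  (hf.contDiffAt hx).differentiableAt (by simp)

theorem SmoothExt.congr (hf : SmoothExt M f) (h : Set.EqOn g f (exterior M)) : SmoothExt M g :=
  ContDiffOn.congr hf h

theorem SmoothExt.add (hf : SmoothExt M f) (hg : SmoothExt M g) :
    SmoothExt M (fun y => f y + g y) := ContDiffOn.add hf hg

theorem SmoothExt.sub (hf : SmoothExt M f) (hg : SmoothExt M g) :
    SmoothExt M (fun y => f y - g y) := ContDiffOn.sub hf hg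

theorem SmoothExt.mul (hf : SmoothExt M f) (hg : SmoothExt M g) :
    SmoothExt M (fun y => f y * g y) := ContDiffOn.mul hf hg

theorem SmoothExt.const (a : ℝ) : SmoothExt M (fun _ => a) := contDiffOn_const

theorem SmoothExt.sum {ι : Type*} {s : Finset ι} {F : ι → (Fin 4 → ℝ) → ℝ}
    (hF : ∀ i ∈ s, SmoothExt M (F i)) : SmoothExt M (fun y => ∑ i ∈ s, F i y) :=
  ContDiffOn.sum hF

theorem SmoothExt.pd (hf : SmoothExt M f) (a : Fin 4) : SmoothExt M (pd a f) :=
  (ContDiffOn.fderiv_of_isOpen hf (isOpen_exterior M) (m := ∞) (by simp)).clm_apply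
    contDiffOn_const

theorem pd_congr (h : Set.EqOn f g (exterior M)) (hx : x ∈ exterior M) (a : Fin 4) :
    pd a f x = pd a g x := by
  have : f =ᶠ[nhds x] g := h.eventuallyEq_of_mem ((isOpen_exterior M).mem_nhds hx)
  simp only [pd, this.fderiv_eq]

theorem pd_const (c : ℝ) (a : Fin 4) : pd a (fun _ => c) x = 0 := by simp [pd]

theorem pd_eq_zero_of_eqOn (h : ∀ y ∈ exterior M, f y = 0) (hx : x ∈ exterior M) (a : Fin 4) :
    pd a f x = 0 := by
  rw [pd_congr (g := fun _ => 0) h hx, pd_const]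

theorem pd_add (hf : SmoothExt M f) (hg : SmoothExt M g) (hx : x ∈ exterior M) (a : Fin 4) :
    pd a (fun y => f y + g y) x = pd a f x + pd a g x := by
  simp only [pd]
  rw [fderiv_fun_add (hf.differentiableAt hx) (hg.differentiableAt hx)]; rfl

theorem pd_sub (hf : SmoothExt M f) (hg : SmoothExt M g) (hx : x ∈ exterior M) (a : Fin 4) :
    pd a (fun y => f y - g y) x = pd a f x - pd a g x := by
  simp only [pd]
  rw [fderiv_fun_sub (hf.differentiableAt hx) (hg.differentiableAt hx)]; rfl

theorem pd_mul (hf : SmoothExt M f) (hg : SmoothExt M g) (hx : x ∈ exterior M) (a : Fin 4) :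
    pd a (fun y => f y * g y) x = pd a f x * g x + f x * pd a g x := by
  simp only [pd]
  rw [fderiv_fun_mul (hf.differentiableAt hx) (hg.differentiableAt hx)]
  simp; ring

theorem pd_sum {ι : Type*} {s : Finset ι} {F : ι → (Fin 4 → ℝ) → ℝ}
    (hF : ∀ i ∈ s, SmoothExt M (F i)) (hx : x ∈ exterior M) (a : Fin 4) :
    pd a (fun y => ∑ i ∈ s, F i y) x = ∑ i ∈ s, pd a (F i) x := by
  simp only [pd]
  rw [fderiv_fun_sum (fun i hi => (hF i hi).differentiableAt hx)]
  simp

theorem pd_comm (hf : SmoothExt M f) (hx : x ∈ exterior M) (a b : Fin 4) :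
    pd a (pd b f) x = pd b (pd a f) x := by
  have hd : DifferentiableAt ℝ (fderiv ℝ f) x :=
    ((hf.contDiffAt hx).fderiv_right (m := 1) (by norm_cast)).differentiableAt (by simp)
  have key : ∀ i j : Fin 4, pd i (pd j f) x
      = fderiv ℝ (fderiv ℝ f) x (Pi.single i 1) (Pi.single j 1) := by
    intro i j
    show fderiv ℝ (fun y => fderiv ℝ f y (Pi.single j 1)) x (Pi.single i 1) = _
    rw [fderiv_clm_apply hd (differentiableAt_const _)]
    simp
  rw [key, key]
  exact ((hf.contDiffAt hx).isSymmSndFDerivAt (by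
    rw [minSmoothness_of_isRCLikeNormedField]
    exact WithTop.coe_le_coe.2 (le_top : (2 : ℕ∞) ≤ ⊤))).eq _ _

/-- A coordinate derivative is the derivative along the coordinate line. -/
theorem hasDerivAt_comp_update (hf : DifferentiableAt ℝ f x) (a : Fin 4) :
    HasDerivAt (fun s => f (Function.update x a s)) (pd a f x) (x a) := by
  have h1 : HasDerivAt (fun s => Function.update x a s) (Pi.single a 1) (x a) :=
    hasDerivAt_update x a (x a)
  have h2 : HasFDerivAt f (fderiv ℝ f x) (Function.update x a (x a)) := by
    rw [Function.update_eq_self]; exact hf.hasFDerivAt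
  exact h2.comp_hasDerivAt (x a) h1

theorem pd_eq_of_hasDerivAt (hf : SmoothExt M f) (hx : x ∈ exterior M) {a : Fin 4} {f' : ℝ}
    (h : HasDerivAt (fun s => f (Function.update x a s)) f' (x a)) : pd a f x = f' :=
  (hasDerivAt_comp_update (hf.differentiableAt hx) a).unique h

/-- A smooth function with vanishing `∂ₐ` is constant along the `a`-th coordinate lines. -/
theorem eq_update_of_pd_eq_zero (hf : SmoothExt M f) {a : Fin 4}
    (h : ∀ s, Function.update x a s ∈ exterior M → pd a f (Function.update x a s) = 0)
    (hx : x ∈ exterior M) {s : ℝ} (hs : Function.update x a s ∈ exterior M) :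
    f (Function.update x a s) = f x := by
  have hconv : Convex ℝ {u : ℝ | Function.update x a u ∈ exterior M} := by
    have : {u : ℝ | Function.update x a u ∈ exterior M}.OrdConnected := by
      constructor
      rintro u hu v hv w ⟨hw1, hw2⟩
      simp only [exterior, Set.mem_ofPred_eq] at hu hv ⊢
      refine ⟨?_, ?_, ?_⟩ <;> fin_cases a <;> simp at hu hv ⊢ <;>
        linarith
    exact this.convex
  have hd : ∀ u ∈ {u : ℝ | Function.update x a u ∈ exterior M},
      HasDerivWithinAt (fun u => f (Function.update x a u)) 0
        {u : ℝ | Function.update x a u ∈ exterior M} u := by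
    intro u hu
    have := hasDerivAt_comp_update (hf.differentiableAt hu) a
    simp only [Function.update_idem, Function.update_self] at this
    rw [h u hu] at this
    exact this.hasDerivWithinAt
  have h0 : x a ∈ {u : ℝ | Function.update x a u ∈ exterior M} := by
    simpa using hx
  have := hconv.norm_image_sub_le_of_norm_hasDerivWithin_le (C := 0) hd (by simp) h0 hs
  simp only [Function.update_eq_self, zero_mul, norm_le_zero_iff] at this
  linarith

theorem eventually_update_mem_exterior (hx : x ∈ exterior M) (a : Fin 4) :
    ∀ᶠ s in nhds (x a), Function.update x a s ∈ exterior M := by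
  have hc : Continuous fun s : ℝ => Function.update x a s := continuous_const.update a continuous_id
  apply hc.continuousAt.eventually_mem
  rw [Function.update_eq_self]
  exact (isOpen_exterior M).mem_nhds hx

/-- Derivatives tangent to the slice `t = 0` of a function vanishing there vanish. -/
theorem pd_eq_zero_on_slice (hf : SmoothExt M f) (h : ∀ y ∈ exterior M, y 0 = 0 → f y = 0)
    {a : Fin 4} (ha : a ≠ 0) (hx : x ∈ exterior M) (hx0 : x 0 = 0) : pd a f x = 0 := by
  apply pd_eq_of_hasDerivAt hf hx
  refine (hasDerivAt_const (x a) (0 : ℝ)).congr_of_eventuallyEq ?_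
  filter_upwards [eventually_update_mem_exterior hx a] with s hs
  exact h _ hs (by rw [Function.update_of_ne ha.symm]; exact hx0)

end

noncomputable section

/-! ### Christoffel symbols and their derivatives -/

/-- The Christoffel symbols as functions of `r`, `D = r - 2M`, `s = sin θ`, `c = cos θ`. Writing
`M = (r - D) / 2` makes all coefficients Laurent polynomials in `r`, `D`, `s`, `c`. -/
def gam (r D s c : ℝ) : Fin 4 → Fin 4 → Fin 4 → ℝ :=
  ![![![0, (1 / D - 1 / r) / 2, 0, 0], ![(1 / D - 1 / r) / 2, 0, 0, 0], 0, 0],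
    ![![D / (2 * r ^ 2) - D ^ 2 / (2 * r ^ 3), 0, 0, 0], ![0, (1 / r - 1 / D) / 2, 0, 0],
      ![0, 0, -D, 0], ![0, 0, 0, -D * s ^ 2]],
    ![0, ![0, 0, 1 / r, 0], ![0, 1 / r, 0, 0], ![0, 0, 0, -s * c]],
    ![0, ![0, 0, 0, 1 / r], ![0, 0, 0, c / s], ![0, 1 / r, c / s, 0]]]

/-- The first derivatives `∂_d Γᵉₐᵦ`. -/
def dgam (r D s c : ℝ) : Fin 4 → Fin 4 → Fin 4 → Fin 4 → ℝ :=
  ![0,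
    ![![![0, (1 / r ^ 2 - 1 / D ^ 2) / 2, 0, 0], ![(1 / r ^ 2 - 1 / D ^ 2) / 2, 0, 0, 0], 0, 0],
      ![![1 / (2 * r ^ 2) - 2 * D / r ^ 3 + 3 * D ^ 2 / (2 * r ^ 4), 0, 0, 0],
        ![0, (1 / D ^ 2 - 1 / r ^ 2) / 2, 0, 0], ![0, 0, -1, 0], ![0, 0, 0, -s ^ 2]],
      ![0, ![0, 0, -1 / r ^ 2, 0], ![0, -1 / r ^ 2, 0, 0], 0],
      ![0, ![0, 0, 0, -1 / r ^ 2], 0, ![0, -1 / r ^ 2, 0, 0]]],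
    ![0, ![0, 0, 0, ![0, 0, 0, -2 * D * s * c]], ![0, 0, 0, ![0, 0, 0, 2 * s ^ 2 - 1]],
      ![0, 0, ![0, 0, 0, -1 / s ^ 2], ![0, 0, -1 / s ^ 2, 0]]],
    0]

/-- The second derivatives `∂_d ∂_d' Γᵉₐᵦ`. -/
def ddgam (r D s c : ℝ) : Fin 4 → Fin 4 → Fin 4 → Fin 4 → Fin 4 → ℝ :=
  ![0,
    ![0,
      ![![![0, 1 / D ^ 3 - 1 / r ^ 3, 0, 0], ![1 / D ^ 3 - 1 / r ^ 3, 0, 0, 0], 0, 0],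
        ![![-3 / r ^ 3 + 9 * D / r ^ 4 - 6 * D ^ 2 / r ^ 5, 0, 0, 0],
          ![0, 1 / r ^ 3 - 1 / D ^ 3, 0, 0], 0, 0],
        ![0, ![0, 0, 2 / r ^ 3, 0], ![0, 2 / r ^ 3, 0, 0], 0],
        ![0, ![0, 0, 0, 2 / r ^ 3], 0, ![0, 2 / r ^ 3, 0, 0]]],
      ![0, ![0, 0, 0, ![0, 0, 0, -2 * s * c]], 0, 0],
      0],
    ![0,
      ![0, ![0, 0, 0, ![0, 0, 0, -2 * s * c]], 0, 0],
      ![0, ![0, 0, 0, ![0, 0, 0, 2 * D * (2 * s ^ 2 - 1)]], ![0, 0, 0, ![0, 0, 0, 4 * s * c]],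
        ![0, 0, ![0, 0, 0, 2 * c / s ^ 3], ![0, 0, 2 * c / s ^ 3, 0]]],
      0],
    0]

/-- The Christoffel symbols at a point of the exterior. -/
abbrev gamAt (M : ℝ) (x : Fin 4 → ℝ) : Fin 4 → Fin 4 → Fin 4 → ℝ :=
  gam (x 1) (x 1 - 2 * M) (Real.sin (x 2)) (Real.cos (x 2))

/-- The first derivatives of the Christoffel symbols at a point of the exterior. -/
abbrev dgamAt (M : ℝ) (x : Fin 4 → ℝ) : Fin 4 → Fin 4 → Fin 4 → Fin 4 → ℝ :=
  dgam (x 1) (x 1 - 2 * M) (Real.sin (x 2)) (Real.cos (x 2))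

/-- The second derivatives of the Christoffel symbols at a point of the exterior. -/
abbrev ddgamAt (M : ℝ) (x : Fin 4 → ℝ) : Fin 4 → Fin 4 → Fin 4 → Fin 4 → Fin 4 → ℝ :=
  ddgam (x 1) (x 1 - 2 * M) (Real.sin (x 2)) (Real.cos (x 2))

variable {M : ℝ} {x : Fin 4 → ℝ}

theorem smoothExt_r : SmoothExt M (fun y => y 1) := (contDiff_apply ℝ ℝ 1).contDiffOn

theorem smoothExt_D : SmoothExt M (fun y => y 1 - 2 * M) := smoothExt_r.sub (.const _)

theorem smoothExt_sin : SmoothExt M (fun y => Real.sin (y 2)) :=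
  (Real.contDiff_sin.comp (contDiff_apply ℝ ℝ 2)).contDiffOn

theorem smoothExt_cos : SmoothExt M (fun y => Real.cos (y 2)) :=
  (Real.contDiff_cos.comp (contDiff_apply ℝ ℝ 2)).contDiffOn

theorem D_pos (hx : x ∈ exterior M) : 0 < x 1 - 2 * M := by linarith [hx.1]

theorem r_pos (hM : 0 < M) (hx : x ∈ exterior M) : 0 < x 1 := by linarith [hx.1]

theorem sin_pos_of_mem (hx : x ∈ exterior M) : 0 < Real.sin (x 2) :=
  Real.sin_pos_of_pos_of_lt_pi hx.2.1 hx.2.2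

theorem smoothExt_gamAt (hM : 0 < M) (e a b : Fin 4) :
    SmoothExt M (fun y => gamAt M y e a b) := by
  have hr : ∀ y ∈ exterior M, y 1 ≠ 0 := fun y hy => (r_pos hM hy).ne'
  have hr2 : ∀ y ∈ exterior M, 2 * y 1 ^ 2 ≠ 0 := fun y hy => by simp [hr y hy]
  have hr3 : ∀ y ∈ exterior M, 2 * y 1 ^ 3 ≠ 0 := fun y hy => by simp [hr y hy]
  have hD : ∀ y ∈ exterior M, y 1 - 2 * M ≠ 0 := fun y hy => (D_pos hy).ne'
  have hs : ∀ y ∈ exterior M, Real.sin (y 2) ≠ 0 := fun y hy => (sin_pos_of_mem hy).ne'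
  have h1 : ContDiffOn ℝ ∞ (fun y : Fin 4 → ℝ => y 1) (exterior M) := smoothExt_r
  have h2 : ContDiffOn ℝ ∞ (fun y : Fin 4 → ℝ => y 1 - 2 * M) (exterior M) := smoothExt_D
  have h3 : ContDiffOn ℝ ∞ (fun y : Fin 4 → ℝ => Real.sin (y 2)) (exterior M) := smoothExt_sin
  have h4 : ContDiffOn ℝ ∞ (fun y : Fin 4 → ℝ => Real.cos (y 2)) (exterior M) := smoothExt_cos
  have h0 : ContDiffOn ℝ ∞ (fun _ : Fin 4 → ℝ => (0 : ℝ)) (exterior M) := contDiffOn_const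
  have p1 := (contDiffOn_const (c := (1 : ℝ))).div h1 hr
  have p2 := ((((contDiffOn_const (c := (1 : ℝ))).div h2 hD).sub p1).div_const 2)
  have p3 := ((p1.sub ((contDiffOn_const (c := (1 : ℝ))).div h2 hD)).div_const 2)
  have p4 := (h2.div (contDiffOn_const.mul (h1.pow 2)) hr2).sub
    ((h2.pow 2).div (contDiffOn_const.mul (h1.pow 3)) hr3)
  have p5 := h2.neg.mul (h3.pow 2)
  have p6 := h3.neg.mul h4
  have p7 := h4.div h3 hs
  fin_cases e <;> fin_cases a <;> fin_cases b <;>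
    first | exact h0 | exact p1 | exact p2 | exact p3 | exact p4 | exact h2.neg | exact p5 |
      exact p6 | exact p7

theorem hasDerivAt_gam_r {r M : ℝ} (s c : ℝ) (hr : r ≠ 0) (hD : r - 2 * M ≠ 0) (e a b : Fin 4) :
    HasDerivAt (fun ρ => gam ρ (ρ - 2 * M) s c e a b) (dgam r (r - 2 * M) s c 1 e a b) r := by
  have h0 : HasDerivAt (fun _ : ℝ => (0 : ℝ)) 0 r := hasDerivAt_const _ _
  have hsc : ∀ k : ℝ, HasDerivAt (fun _ : ℝ => k) 0 r := fun k => hasDerivAt_const _ _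
  have h1 := hasDerivAt_id' r
  have h2 : HasDerivAt (fun ρ : ℝ => ρ - 2 * M) 1 r := h1.sub_const _
  have q1 : HasDerivAt (fun ρ : ℝ => 1 / ρ) (-1 / r ^ 2) r := by
    exact ((hsc 1).div h1 hr).congr_deriv (by ring)
  have q2 : HasDerivAt (fun ρ : ℝ => 1 / (ρ - 2 * M)) (-1 / (r - 2 * M) ^ 2) r := by
    exact ((hsc 1).div h2 hD).congr_deriv (by ring)
  have q3 : HasDerivAt (fun ρ : ℝ => (1 / (ρ - 2 * M) - 1 / ρ) / 2)
      ((1 / r ^ 2 - 1 / (r - 2 * M) ^ 2) / 2) r := by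
    exact ((q2.sub q1).div_const 2).congr_deriv (by ring)
  have q4 : HasDerivAt (fun ρ : ℝ => (1 / ρ - 1 / (ρ - 2 * M)) / 2)
      ((1 / (r - 2 * M) ^ 2 - 1 / r ^ 2) / 2) r := by
    exact ((q1.sub q2).div_const 2).congr_deriv (by ring)
  have q5 : HasDerivAt (fun ρ : ℝ => (ρ - 2 * M) / (2 * ρ ^ 2) - (ρ - 2 * M) ^ 2 / (2 * ρ ^ 3))
      (1 / (2 * r ^ 2) - 2 * (r - 2 * M) / r ^ 3 + 3 * (r - 2 * M) ^ 2 / (2 * r ^ 4)) r := by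
    refine ((h2.div ((h1.pow 2).const_mul 2) (by simp [hr])).sub
      ((h2.pow 2).div ((h1.pow 3).const_mul 2) (by simp [hr]))).congr_deriv ?_
    simp only [Nat.cast_ofNat, Pi.pow_apply]
    field_simp
    ring
  have q6 : HasDerivAt (fun ρ : ℝ => -(ρ - 2 * M)) (-1) r := h2.neg
  have q7 : HasDerivAt (fun ρ : ℝ => -(ρ - 2 * M) * s ^ 2) (-s ^ 2) r := by
    exact (q6.mul_const (s ^ 2)).congr_deriv (by ring)
  fin_cases e <;> fin_cases a <;> fin_cases b <;>
    first | exact h0 | exact q1 | exact q3 | exact q4 | exact q5 | exact q6 | exact q7 |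
      exact hsc _

theorem hasDerivAt_gam_θ (r D : ℝ) {θ : ℝ} (hs : Real.sin θ ≠ 0) (e a b : Fin 4) :
    HasDerivAt (fun τ => gam r D (Real.sin τ) (Real.cos τ) e a b)
      (dgam r D (Real.sin θ) (Real.cos θ) 2 e a b) θ := by
  have h0 : ∀ k : ℝ, HasDerivAt (fun _ : ℝ => k) 0 θ := fun k => hasDerivAt_const _ _
  have h1 := Real.hasDerivAt_sin θ
  have h2 := Real.hasDerivAt_cos θ
  have q1 : HasDerivAt (fun τ : ℝ => -D * Real.sin τ ^ 2) (-2 * D * Real.sin θ * Real.cos θ) θ := by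
    exact ((h1.pow 2).const_mul (-D)).congr_deriv (by ring)
  have q2 : HasDerivAt (fun τ : ℝ => -Real.sin τ * Real.cos τ)
      (2 * Real.sin θ ^ 2 - 1) θ := by
    exact (h1.neg.mul h2).congr_deriv (by
      simp only [Pi.neg_apply]; linear_combination -Real.sin_sq_add_cos_sq θ)
  have q3 : HasDerivAt (fun τ : ℝ => Real.cos τ / Real.sin τ) (-1 / Real.sin θ ^ 2) θ := by
    exact (h2.div h1 hs).congr_deriv (by
      rw [show -1 = -Real.sin θ * Real.sin θ - Real.cos θ * Real.cos θ by
        linarith [Real.sin_sq_add_cos_sq θ]])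
  fin_cases e <;> fin_cases a <;> fin_cases b <;>
    first | exact h0 _ | exact q1 | exact q2 | exact q3

theorem pd_gamAt (hM : 0 < M) (hx : x ∈ exterior M) (d e a b : Fin 4) :
    pd d (fun y => gamAt M y e a b) x = dgamAt M x d e a b := by
  apply pd_eq_of_hasDerivAt (smoothExt_gamAt hM e a b) hx
  fin_cases d
  · simpa [gamAt, dgamAt, dgam] using hasDerivAt_const (x 0) _
  · simpa [gamAt, dgamAt] using hasDerivAt_gam_r (Real.sin (x 2)) (Real.cos (x 2))
      (r_pos hM hx).ne' (D_pos hx).ne' e a b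
  · simpa [gamAt, dgamAt] using hasDerivAt_gam_θ (x 1) (x 1 - 2 * M) (sin_pos_of_mem hx).ne' e a b
  · simpa [gamAt, dgamAt, dgam] using hasDerivAt_const (x 3) _

end

noncomputable section

variable {M : ℝ} {x : Fin 4 → ℝ}

theorem hasDerivAt_dgam_r {r M : ℝ} (s c : ℝ) (hr : r ≠ 0) (hD : r - 2 * M ≠ 0)
    (d e a b : Fin 4) :
    HasDerivAt (fun ρ => dgam ρ (ρ - 2 * M) s c d e a b) (ddgam r (r - 2 * M) s c 1 d e a b) r := by
  have hsc : ∀ k : ℝ, HasDerivAt (fun _ : ℝ => k) 0 r := fun k => hasDerivAt_const _ _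
  have h1 := hasDerivAt_id' r
  have h2 : HasDerivAt (fun ρ : ℝ => ρ - 2 * M) 1 r := h1.sub_const _
  have q1 : HasDerivAt (fun ρ : ℝ => 1 / ρ ^ 2) (-2 / r ^ 3) r :=
    ((hsc 1).div (h1.pow 2) (by simp [hr])).congr_deriv (by
      simp only [Pi.pow_apply]; field_simp; ring)
  have q1' : HasDerivAt (fun ρ : ℝ => -1 / ρ ^ 2) (2 / r ^ 3) r :=
    ((hsc (-1)).div (h1.pow 2) (by simp [hr])).congr_deriv (by
      simp only [Pi.pow_apply]; field_simp; ring)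
  have q2 : HasDerivAt (fun ρ : ℝ => 1 / (ρ - 2 * M) ^ 2) (-2 / (r - 2 * M) ^ 3) r :=
    ((hsc 1).div (h2.pow 2) (by simp [hD])).congr_deriv (by
      simp only [Pi.pow_apply]; field_simp; ring)
  have q3 : HasDerivAt (fun ρ : ℝ => (1 / ρ ^ 2 - 1 / (ρ - 2 * M) ^ 2) / 2)
      (1 / (r - 2 * M) ^ 3 - 1 / r ^ 3) r :=
    ((q1.sub q2).div_const 2).congr_deriv (by ring)
  have q4 : HasDerivAt (fun ρ : ℝ => (1 / (ρ - 2 * M) ^ 2 - 1 / ρ ^ 2) / 2)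
      (1 / r ^ 3 - 1 / (r - 2 * M) ^ 3) r :=
    ((q2.sub q1).div_const 2).congr_deriv (by ring)
  have q5 : HasDerivAt (fun ρ : ℝ => 1 / (2 * ρ ^ 2) - 2 * (ρ - 2 * M) / ρ ^ 3
      + 3 * (ρ - 2 * M) ^ 2 / (2 * ρ ^ 4))
      (-3 / r ^ 3 + 9 * (r - 2 * M) / r ^ 4 - 6 * (r - 2 * M) ^ 2 / r ^ 5) r := by
    refine ((((hsc 1).div ((h1.pow 2).const_mul 2) (by simp [hr])).sub
      ((h2.const_mul 2).div (h1.pow 3) (by simp [hr]))).add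
      (((h2.pow 2).const_mul 3).div ((h1.pow 4).const_mul 2) (by simp [hr]))).congr_deriv ?_
    simp only [Nat.cast_ofNat, Pi.pow_apply]
    field_simp
    ring
  have q6 : HasDerivAt (fun ρ : ℝ => -2 * (ρ - 2 * M) * s * c) (-2 * s * c) r :=
    (((h2.const_mul (-2)).mul_const s).mul_const c).congr_deriv (by ring)
  fin_cases d <;> fin_cases e <;> fin_cases a <;> fin_cases b <;>
    first | exact hsc _ | exact q1' | exact q3 | exact q4 | exact q5 | exact q6

theorem hasDerivAt_dgam_θ (r D : ℝ) {θ : ℝ} (hs : Real.sin θ ≠ 0) (d e a b : Fin 4) :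
    HasDerivAt (fun τ => dgam r D (Real.sin τ) (Real.cos τ) d e a b)
      (ddgam r D (Real.sin θ) (Real.cos θ) 2 d e a b) θ := by
  have h0 : ∀ k : ℝ, HasDerivAt (fun _ : ℝ => k) 0 θ := fun k => hasDerivAt_const _ _
  have h1 := Real.hasDerivAt_sin θ
  have h2 := Real.hasDerivAt_cos θ
  have q1 : HasDerivAt (fun τ : ℝ => -Real.sin τ ^ 2) (-2 * Real.sin θ * Real.cos θ) θ :=
    ((h1.pow 2).neg).congr_deriv (by simp)
  have q2 : HasDerivAt (fun τ : ℝ => -2 * D * Real.sin τ * Real.cos τ)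
      (2 * D * (2 * Real.sin θ ^ 2 - 1)) θ :=
    ((h1.const_mul (-2 * D)).mul h2).congr_deriv (by
      linear_combination -2 * D * Real.sin_sq_add_cos_sq θ)
  have q3 : HasDerivAt (fun τ : ℝ => 2 * Real.sin τ ^ 2 - 1)
      (4 * Real.sin θ * Real.cos θ) θ :=
    (((h1.pow 2).const_mul 2).sub_const 1).congr_deriv (by simp; ring)
  have q4 : HasDerivAt (fun τ : ℝ => -1 / Real.sin τ ^ 2) (2 * Real.cos θ / Real.sin θ ^ 3) θ :=
    ((h0 (-1)).div (h1.pow 2) (by simp [hs])).congr_deriv (by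
      simp only [Pi.pow_apply]; field_simp; ring)
  fin_cases d <;> fin_cases e <;> fin_cases a <;> fin_cases b <;>
    first | exact h0 _ | exact q1 | exact q2 | exact q3 | exact q4

theorem smoothExt_dgamAt (hM : 0 < M) (d e a b : Fin 4) :
    SmoothExt M (fun y => dgamAt M y d e a b) :=
  ((smoothExt_gamAt hM e a b).pd d).congr fun _ hy => (pd_gamAt hM hy d e a b).symm

theorem pd_dgamAt (hM : 0 < M) (hx : x ∈ exterior M) (d' d e a b : Fin 4) :
    pd d' (fun y => dgamAt M y d e a b) x = ddgamAt M x d' d e a b := by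
  apply pd_eq_of_hasDerivAt (smoothExt_dgamAt hM d e a b) hx
  fin_cases d'
  · simpa [ddgamAt, dgamAt, ddgam] using hasDerivAt_const (x 0) _
  · simpa [ddgamAt, dgamAt] using hasDerivAt_dgam_r (Real.sin (x 2)) (Real.cos (x 2))
      (r_pos hM hx).ne' (D_pos hx).ne' d e a b
  · simpa [ddgamAt, dgamAt] using hasDerivAt_dgam_θ (x 1) (x 1 - 2 * M) (sin_pos_of_mem hx).ne'
      d e a b
  · simpa [ddgamAt, dgamAt, ddgam] using hasDerivAt_const (x 3) _

/-! ### The Christoffel symbols of the Schwarzschild metric -/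

/-- The diagonal entries of the inverse metric. -/
def ginv (r D s : ℝ) : Fin 4 → ℝ := ![-(r / D), D / r, 1 / r ^ 2, 1 / (r ^ 2 * s ^ 2)]

/-- The derivatives of the diagonal entries of the metric. -/
def dmet (r D s c : ℝ) : Fin 4 → Fin 4 → ℝ :=
  ![0, ![(D - r) / r ^ 2, (D - r) / D ^ 2, 2 * r, 2 * r * s ^ 2],
    ![0, 0, 0, 2 * r ^ 2 * s * c], 0]

theorem metric_inv_apply (hM : 0 < M) (hx : x ∈ exterior M) (a b : Fin 4) :
    (metric M x)⁻¹ a b = if a = b then ginv (x 1) (x 1 - 2 * M) (Real.sin (x 2)) a else 0 := by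
  have hr := (r_pos hM hx).ne'
  have hD := (D_pos hx).ne'
  have hs := (sin_pos_of_mem hx).ne'
  have hf : 1 - 2 * M / x 1 = (x 1 - 2 * M) / x 1 := by field_simp
  have : (metric M x)⁻¹ = Matrix.diagonal (ginv (x 1) (x 1 - 2 * M) (Real.sin (x 2))) := by
    apply Matrix.inv_eq_right_inv
    rw [metric, Matrix.diagonal_mul_diagonal, ← Matrix.diagonal_one, hf]
    congr 1
    funext i
    fin_cases i <;> simp [ginv] <;> field_simp
  rw [this, Matrix.diagonal_apply]

theorem pd_metric (hM : 0 < M) (hx : x ∈ exterior M) (d a b : Fin 4) :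
    pd d (fun y => metric M y a b) x =
      if a = b then dmet (x 1) (x 1 - 2 * M) (Real.sin (x 2)) (Real.cos (x 2)) d a else 0 := by
  have hr := (r_pos hM hx).ne'
  have hD := (D_pos hx).ne'
  have hs := (sin_pos_of_mem hx).ne'
  split_ifs with hab
  swap
  · simp [metric, Matrix.diagonal_apply_ne _ hab, pd_const]
  subst hab
  simp only [metric, Matrix.diagonal_apply_eq]
  have h1 : ContDiffOn ℝ ∞ (fun y : Fin 4 → ℝ => y 1) (exterior M) := smoothExt_r
  have p0 : ContDiffOn ℝ ∞ (fun y : Fin 4 → ℝ => 1 - 2 * M / y 1) (exterior M) :=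
    contDiffOn_const.sub (contDiffOn_const.div h1 fun y hy => (r_pos hM hy).ne')
  have hf : ∀ y ∈ exterior M, 1 - 2 * M / y 1 ≠ 0 := fun y hy => by
    have := (D_pos hy).ne'
    have h := (r_pos hM hy).ne'
    rw [show 1 - 2 * M / y 1 = (y 1 - 2 * M) / y 1 by field_simp]
    positivity
  have hsm : SmoothExt M (fun y => (![-(1 - 2 * M / y 1), (1 - 2 * M / y 1)⁻¹, y 1 ^ 2,
      y 1 ^ 2 * Real.sin (y 2) ^ 2] : Fin 4 → ℝ) a) := by
    fin_cases a
    · exact p0.neg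
    · exact p0.inv hf
    · exact h1.pow 2
    · exact (h1.pow 2).mul (ContDiffOn.pow smoothExt_sin 2)
  apply pd_eq_of_hasDerivAt hsm hx
  have c0 : ∀ k t : ℝ, HasDerivAt (fun _ : ℝ => k) 0 t := fun k t => hasDerivAt_const _ _
  have k1 := hasDerivAt_id' (x 1)
  have k2 := Real.hasDerivAt_sin (x 2)
  have q0 : HasDerivAt (fun ρ : ℝ => 1 - 2 * M / ρ) (2 * M / x 1 ^ 2) (x 1) :=
    ((c0 1 _).sub ((c0 (2 * M) _).div k1 hr)).congr_deriv (by ring)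
  have q1 : HasDerivAt (fun ρ : ℝ => -(1 - 2 * M / ρ)) ((x 1 - 2 * M - x 1) / x 1 ^ 2) (x 1) :=
    q0.neg.congr_deriv (by ring)
  have q2 : HasDerivAt (fun ρ : ℝ => (1 - 2 * M / ρ)⁻¹)
      ((x 1 - 2 * M - x 1) / (x 1 - 2 * M) ^ 2) (x 1) :=
    (q0.inv (hf x hx)).congr_deriv (by
      rw [show 1 - 2 * M / x 1 = (x 1 - 2 * M) / x 1 by field_simp]; field_simp; ring)
  have q3 : HasDerivAt (fun ρ : ℝ => ρ ^ 2) (2 * x 1) (x 1) :=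
    (k1.pow 2).congr_deriv (by simp)
  have q4 : HasDerivAt (fun ρ : ℝ => ρ ^ 2 * Real.sin (x 2) ^ 2) (2 * x 1 * Real.sin (x 2) ^ 2)
    (x 1) := q3.mul_const _
  have q5 : HasDerivAt (fun τ : ℝ => x 1 ^ 2 * Real.sin τ ^ 2)
      (2 * x 1 ^ 2 * Real.sin (x 2) * Real.cos (x 2)) (x 2) :=
    ((k2.pow 2).const_mul (x 1 ^ 2)).congr_deriv (by simp; ring)
  fin_cases d <;> fin_cases a <;>
    simp only [Fin.zero_eta, Fin.mk_one, Fin.reduceFinMk, dmet, Matrix.cons_val, Pi.zero_apply,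
      Function.update_self, ne_eq, Fin.reduceEq, not_false_eq_true, Function.update_of_ne,
      one_ne_zero] <;>
    first | exact c0 _ _ | exact q1 | exact q2 | exact q3 | exact q4 | exact q5

theorem christoffel_eq (hM : 0 < M) (hx : x ∈ exterior M) (e a b : Fin 4) :
    christoffel M e a b x = gamAt M x e a b := by
  have hr := (r_pos hM hx).ne'
  have hD := (D_pos hx).ne'
  have hs := (sin_pos_of_mem hx).ne'
  simp only [christoffel, metric_inv_apply hM hx, pd_metric hM hx, ite_mul, zero_mul,
    Finset.sum_ite_eq, Finset.mem_univ, if_true, gamAt]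
  generalize x 1 - 2 * M = D at *
  generalize Real.sin (x 2) = s at *
  generalize Real.cos (x 2) = c at *
  fin_cases e <;> fin_cases a <;> fin_cases b <;> simp [ginv, dmet, gam] <;>
    first | done | (field_simp; done) | (field_simp; ring)

end

noncomputable section

/-! ### The linearized Ricci tensor on jets -/

section Jets

variable (g : Fin 4 → ℝ) (G : Fin 4 → Fin 4 → Fin 4 → ℝ) (dG : Fin 4 → Fin 4 → Fin 4 → Fin 4 → ℝ)
  (u : Fin 4 → Fin 4 → ℝ) (du : Fin 4 → Fin 4 → Fin 4 → ℝ)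
  (ddu : Fin 4 → Fin 4 → Fin 4 → Fin 4 → ℝ)

/-- `∇ₐ h_bc` in terms of the Christoffel symbols `G` and the 1-jet `u`, `du` of `h`. -/
def jetCov (a b c : Fin 4) : ℝ :=
  du a b c - ∑ e, G e a b * u e c - ∑ e, G e a c * u b e

/-- `∂_d (∇ₐ h_bc)` in terms of the 1-jet `G`, `dG` of the Christoffel symbols and the 2-jet `u`,
`du`, `ddu` of `h`. -/
def jetDCov (d a b c : Fin 4) : ℝ :=
  ddu d a b c - ∑ e, (dG d e a b * u e c + G e a b * du d e c)
    - ∑ e, (dG d e a c * u b e + G e a c * du d b e)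

/-- `∇ₐ ∇_b h_cd` in terms of jets. -/
def jetCovCov (a b c d : Fin 4) : ℝ :=
  jetDCov G dG u du ddu a b c d - ∑ e, G e a b * jetCov G u du e c d
    - ∑ e, G e a c * jetCov G u du b e d - ∑ e, G e a d * jetCov G u du b c e

/-- The linearized Ricci tensor in terms of jets, for a metric whose inverse is diagonal with
entries `g`. -/
def jetRicci (b d : Fin 4) : ℝ :=
  (1 / 2) * ∑ a, g a * (jetCovCov G dG u du ddu a d a b + jetCovCov G dG u du ddu a b a d
    - jetCovCov G dG u du ddu d b a a - jetCovCov G dG u du ddu a a b d)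

end Jets

variable {M : ℝ} {x : Fin 4 → ℝ} {h : Fin 4 → Fin 4 → (Fin 4 → ℝ) → ℝ}

theorem smoothExt_christoffel (hM : 0 < M) (e a b : Fin 4) :
    SmoothExt M (christoffel M e a b) :=
  (smoothExt_gamAt hM e a b).congr fun _ hy => christoffel_eq hM hy e a b

theorem pd_christoffel (hM : 0 < M) (hx : x ∈ exterior M) (d e a b : Fin 4) :
    pd d (christoffel M e a b) x = dgamAt M x d e a b := by
  rw [pd_congr (fun _ hy => christoffel_eq hM hy e a b) hx, pd_gamAt hM hx]

theorem cov₂_eq_jet (hM : 0 < M) (hx : x ∈ exterior M) (a b c : Fin 4) :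
    cov₂ M h a b c x
      = jetCov (gamAt M x) (fun b c => h b c x) (fun a b c => pd a (h b c) x) a b c := by
  simp only [cov₂, jetCov, christoffel_eq hM hx]

theorem pd_cov₂ (hM : 0 < M) (hh : ∀ a b, SmoothExt M (h a b)) (hx : x ∈ exterior M)
    (d a b c : Fin 4) :
    pd d (cov₂ M h a b c) x = jetDCov (gamAt M x) (dgamAt M x) (fun b c => h b c x)
      (fun a b c => pd a (h b c) x) (fun d a b c => pd d (pd a (h b c)) x) d a b c := by
  have k : ∀ e a b c' d', SmoothExt M (fun y => christoffel M e a b y * h c' d' y) :=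
    fun e a b c' d' => (smoothExt_christoffel hM e a b).mul (hh c' d')
  unfold cov₂
  rw [pd_sub (((hh b c).pd a).sub (.sum fun e _ => k e a b e c)) (.sum fun e _ => k e a c b e) hx,
    pd_sub ((hh b c).pd a) (.sum fun e _ => k e a b e c) hx, pd_sum (fun e _ => k e a b e c) hx,
    pd_sum (fun e _ => k e a c b e) hx]
  simp only [pd_mul (smoothExt_christoffel hM _ _ _) (hh _ _) hx, pd_christoffel hM hx,
    christoffel_eq hM hx, jetDCov]

theorem linRicci_eq_jet (hM : 0 < M) (hh : ∀ a b, SmoothExt M (h a b)) (hx : x ∈ exterior M)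
    (b d : Fin 4) :
    linRicci M h b d x = jetRicci (ginv (x 1) (x 1 - 2 * M) (Real.sin (x 2))) (gamAt M x)
      (dgamAt M x) (fun b c => h b c x) (fun a b c => pd a (h b c) x)
      (fun d a b c => pd d (pd a (h b c)) x) b d := by
  have key : ∀ a b c d, covCov M h a b c d x = jetCovCov (gamAt M x) (dgamAt M x)
      (fun b c => h b c x) (fun a b c => pd a (h b c) x)
      (fun d a b c => pd d (pd a (h b c)) x) a b c d := by
    intro a b c d
    simp only [covCov, cov₃, jetCovCov, pd_cov₂ hM hh hx, christoffel_eq hM hx, cov₂_eq_jet hM hx]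
  simp only [linRicci, metric_inv_apply hM hx, ite_mul, zero_mul, Finset.sum_ite_eq,
    Finset.mem_univ, if_true, key, jetRicci]

section Formulas

/-- The symmetries of the 2-jet of a symmetric two-tensor field. -/
structure IsSymmetricJet (u : Fin 4 → Fin 4 → ℝ) (du : Fin 4 → Fin 4 → Fin 4 → ℝ)
    (ddu : Fin 4 → Fin 4 → Fin 4 → Fin 4 → ℝ) : Prop where
  zero : ∀ a b, u a b = u b a
  one : ∀ d a b, du d a b = du d b a
  two : ∀ e d a b, ddu e d a b = ddu e d b a
  comm : ∀ e d a b, ddu e d a b = ddu d e a b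

variable {r D s c : ℝ} {u : Fin 4 → Fin 4 → ℝ} {du : Fin 4 → Fin 4 → Fin 4 → ℝ}
  {ddu : Fin 4 → Fin 4 → Fin 4 → Fin 4 → ℝ}

-- One simp set serves all components, each of which uses only a part of it.
set_option linter.unusedSimpArgs false

/-- The radial momentum constraint; it is of first order in `t`. -/
theorem jetRicci_zero_one (hr : r ≠ 0) (hD : D ≠ 0) (hs : s ≠ 0)
    (hj : IsSymmetricJet u du ddu) :
    jetRicci (ginv r D s) (gam r D s c) (dgam r D s c) u du ddu 0 1 =
      (-c / (2 * r ^ 2 * s)) * du 2 0 1 + (-1 / (2 * r ^ 2)) * ddu 2 2 0 1 +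
      (-1 / (2 * r ^ 2 * s ^ 2)) * ddu 3 3 0 1 + (-c / (2 * r ^ 2 * D * s) +
      c / (2 * r ^ 3 * s)) * u 0 2 + c / (2 * r ^ 2 * s) * du 1 0 2 +
      1 / (2 * r ^ 2) * ddu 1 2 0 2 + (-1 / (2 * r ^ 2 * D) + 1 / (2 * r ^ 3)) * du 2 0 2 +
      1 / (2 * r ^ 2 * s ^ 2) * ddu 1 3 0 3 + (-1 / (2 * r ^ 2 * D * s ^ 2) +
      1 / (2 * r ^ 3 * s ^ 2)) * du 3 0 3 + D / (r ^ 2) * du 0 1 1 +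
      c / (2 * r ^ 2 * s) * du 0 1 2 + 1 / (2 * r ^ 2) * ddu 0 2 1 2 +
      1 / (2 * r ^ 2 * s ^ 2) * ddu 0 3 1 3 + (1 / (4 * r ^ 2 * D) +
      1 / (4 * r ^ 3)) * du 0 2 2 + (-1 / (2 * r ^ 2)) * ddu 0 1 2 2 +
      (1 / (4 * r ^ 2 * D * s ^ 2) + 1 / (4 * r ^ 3 * s ^ 2)) * du 0 3 3 +
      (-1 / (2 * r ^ 2 * s ^ 2)) * ddu 0 1 3 3 := by
  obtain ⟨hu, hdu, hddu, hsymm⟩ := hj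
  simp only [jetRicci, jetCovCov, jetDCov, jetCov, Fin.sum_univ_four, ginv, gam, dgam,
    Matrix.cons_val, Pi.zero_apply, zero_mul, mul_zero, add_zero, zero_add, sub_zero, zero_sub]
  simp only [hu 1 0, hu 2 0, hu 3 0, hu 2 1, hu 3 1, hu 3 2, hdu _ 1 0, hdu _ 2 0, hdu _ 3 0,
    hdu _ 2 1, hdu _ 3 1, hdu _ 3 2, hddu _ _ 1 0, hddu _ _ 2 0, hddu _ _ 3 0, hddu _ _ 2 1,
    hddu _ _ 3 1, hddu _ _ 3 2, hsymm 1 0, hsymm 2 0, hsymm 3 0, hsymm 2 1, hsymm 3 1, hsymm 3 2]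
  field_simp
  ring

/-- The polar momentum constraint. -/
theorem jetRicci_zero_two (hr : r ≠ 0) (hD : D ≠ 0) (hs : s ≠ 0)
    (hj : IsSymmetricJet u du ddu) :
    jetRicci (ginv r D s) (gam r D s c) (dgam r D s c) u du ddu 0 2 =
      D / (2 * r) * ddu 1 2 0 1 + (1 / (2 * r) - D / (2 * r ^ 2)) * du 2 0 1 + (-1 / (r ^ 2) +
      D / (r ^ 3)) * u 0 2 + (-D / (2 * r)) * ddu 1 1 0 2 +
      (-1 / (2 * r ^ 2 * s ^ 2)) * ddu 3 3 0 2 + 1 / (2 * r ^ 2 * s ^ 2) * ddu 2 3 0 3 +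
      (-D / (2 * r)) * ddu 0 2 1 1 + D / (r ^ 2) * du 0 1 2 + D / (2 * r) * ddu 0 1 1 2 +
      c / (2 * r ^ 2 * s) * du 0 2 2 + 1 / (2 * r ^ 2 * s ^ 2) * ddu 0 3 2 3 +
      c / (2 * r ^ 2 * s ^ 3) * du 0 3 3 + (-1 / (2 * r ^ 2 * s ^ 2)) * ddu 0 2 3 3 := by
  obtain ⟨hu, hdu, hddu, hsymm⟩ := hj
  simp only [jetRicci, jetCovCov, jetDCov, jetCov, Fin.sum_univ_four, ginv, gam, dgam,
    Matrix.cons_val, Pi.zero_apply, zero_mul, mul_zero, add_zero, zero_add, sub_zero, zero_sub]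
  simp only [hu 1 0, hu 2 0, hu 3 0, hu 2 1, hu 3 1, hu 3 2, hdu _ 1 0, hdu _ 2 0, hdu _ 3 0,
    hdu _ 2 1, hdu _ 3 1, hdu _ 3 2, hddu _ _ 1 0, hddu _ _ 2 0, hddu _ _ 3 0, hddu _ _ 2 1,
    hddu _ _ 3 1, hddu _ _ 3 2, hsymm 1 0, hsymm 2 0, hsymm 3 0, hsymm 2 1, hsymm 3 1, hsymm 3 2]
  field_simp
  ring

/-- The azimuthal momentum constraint. -/
theorem jetRicci_zero_three (hr : r ≠ 0) (hD : D ≠ 0) (hs : s ≠ 0)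
    (hj : IsSymmetricJet u du ddu) :
    jetRicci (ginv r D s) (gam r D s c) (dgam r D s c) u du ddu 0 3 =
      D / (2 * r) * ddu 1 3 0 1 + (1 / (2 * r) - D / (2 * r ^ 2)) * du 3 0 1 +
      1 / (2 * r ^ 2) * ddu 2 3 0 2 + (-c / (2 * r ^ 2 * s)) * du 3 0 2 + (-1 / (r ^ 2) +
      D / (r ^ 3)) * u 0 3 + (-D / (2 * r)) * ddu 1 1 0 3 + c / (2 * r ^ 2 * s) * du 2 0 3 +
      (-1 / (2 * r ^ 2)) * ddu 2 2 0 3 + (-D / (2 * r)) * ddu 0 3 1 1 + D / (r ^ 2) * du 0 1 3 +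
      D / (2 * r) * ddu 0 1 1 3 + (-1 / (2 * r ^ 2)) * ddu 0 3 2 2 +
      c / (2 * r ^ 2 * s) * du 0 2 3 + 1 / (2 * r ^ 2) * ddu 0 2 2 3 := by
  obtain ⟨hu, hdu, hddu, hsymm⟩ := hj
  simp only [jetRicci, jetCovCov, jetDCov, jetCov, Fin.sum_univ_four, ginv, gam, dgam,
    Matrix.cons_val, Pi.zero_apply, zero_mul, mul_zero, add_zero, zero_add, sub_zero, zero_sub]
  simp only [hu 1 0, hu 2 0, hu 3 0, hu 2 1, hu 3 1, hu 3 2, hdu _ 1 0, hdu _ 2 0, hdu _ 3 0,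
    hdu _ 2 1, hdu _ 3 1, hdu _ 3 2, hddu _ _ 1 0, hddu _ _ 2 0, hddu _ _ 3 0, hddu _ _ 2 1,
    hddu _ _ 3 1, hddu _ _ 3 2, hsymm 1 0, hsymm 2 0, hsymm 3 0, hsymm 2 1, hsymm 3 1, hsymm 3 2]
  field_simp
  ring

set_option maxHeartbeats 2000000 in
/-- The Hamiltonian constraint; no `t` derivatives and no components `h_0a` remain. -/
theorem jetRicci_hamiltonian (hr : r ≠ 0) (hD : D ≠ 0) (hs : s ≠ 0) (hc : c ^ 2 = 1 - s ^ 2)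
    (hj : IsSymmetricJet u du ddu) :
    r / D * jetRicci (ginv r D s) (gam r D s c) (dgam r D s c) u du ddu 0 0
      + D / r * jetRicci (ginv r D s) (gam r D s c) (dgam r D s c) u du ddu 1 1
      + 1 / r ^ 2 * jetRicci (ginv r D s) (gam r D s c) (dgam r D s c) u du ddu 2 2
      + 1 / (r ^ 2 * s ^ 2) * jetRicci (ginv r D s) (gam r D s c) (dgam r D s c) u du ddu 3 3 =
      (4 * D / (r ^ 3) - 2 * D ^ 2 / (r ^ 4)) * u 1 1 + 2 * D ^ 2 / (r ^ 3) * du 1 1 1 +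
      (-D * c / (r ^ 3 * s)) * du 2 1 1 + (-D / (r ^ 3)) * ddu 2 2 1 1 +
      (-D / (r ^ 3 * s ^ 2)) * ddu 3 3 1 1 + (c / (r ^ 3 * s) + D * c / (r ^ 4 * s)) * u 1 2 +
      2 * D * c / (r ^ 3 * s) * du 1 1 2 + 2 * D / (r ^ 3) * ddu 1 2 1 2 + (1 / (r ^ 3) +
      D / (r ^ 4)) * du 2 1 2 + 2 * D / (r ^ 3 * s ^ 2) * ddu 1 3 1 3 + (1 / (r ^ 3 * s ^ 2) +
      D / (r ^ 4 * s ^ 2)) * du 3 1 3 + (-1 / (r ^ 4) - D / (r ^ 5)) * u 2 2 +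
      (-1 / (2 * r ^ 3) + 3 * D / (2 * r ^ 4)) * du 1 2 2 + (-D / (r ^ 3)) * ddu 1 1 2 2 +
      c / (r ^ 4 * s) * du 2 2 2 + (-1 / (r ^ 4 * s ^ 2)) * ddu 3 3 2 2 +
      2 / (r ^ 4 * s ^ 2) * ddu 2 3 2 3 +
      (1 / (r ^ 4 * s ^ 2) - 2 / (r ^ 4 * s ^ 4) - D / (r ^ 5 * s ^ 2)) * u 3 3 +
      (-1 / (2 * r ^ 3 * s ^ 2) + 3 * D / (2 * r ^ 4 * s ^ 2)) * du 1 3 3 +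
      (-D / (r ^ 3 * s ^ 2)) * ddu 1 1 3 3 + 2 * c / (r ^ 4 * s ^ 3) * du 2 3 3 +
      (-1 / (r ^ 4 * s ^ 2)) * ddu 2 2 3 3 := by
  obtain ⟨hu, hdu, hddu, hsymm⟩ := hj
  simp only [jetRicci, jetCovCov, jetDCov, jetCov, Fin.sum_univ_four, ginv, gam, dgam,
    Matrix.cons_val, Pi.zero_apply, zero_mul, mul_zero, add_zero, zero_add, sub_zero, zero_sub]
  simp only [hu 1 0, hu 2 0, hu 3 0, hu 2 1, hu 3 1, hu 3 2, hdu _ 1 0, hdu _ 2 0, hdu _ 3 0,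
    hdu _ 2 1, hdu _ 3 1, hdu _ 3 2, hddu _ _ 1 0, hddu _ _ 2 0, hddu _ _ 3 0, hddu _ _ 2 1,
    hddu _ _ 3 1, hddu _ _ 3 2, hsymm 1 0, hsymm 2 0, hsymm 3 0, hsymm 2 1, hsymm 3 1, hsymm 3 2]
  field_simp
  ring_nf
  simp only [hc]
  ring

end Formulas
end

noncomputable section

theorem isSymmetricJet_of_smooth {M : ℝ} {x : Fin 4 → ℝ} {h : Fin 4 → Fin 4 → (Fin 4 → ℝ) → ℝ}
    (hh : ∀ a b, SmoothExt M (h a b)) (hsymm : ∀ a b, h a b = h b a) (hx : x ∈ exterior M) :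
    IsSymmetricJet (fun b c => h b c x) (fun a b c => pd a (h b c) x)
      (fun d a b c => pd d (pd a (h b c)) x) where
  zero a b := by simp only [hsymm a b]
  one d a b := by simp only [hsymm a b]
  two e d a b := by simp only [hsymm a b]
  comm e d a b := pd_comm (hh a b) hx e d

/-! ### Gauge invariance of the constraint components -/

section Jets

variable (G : Fin 4 → Fin 4 → Fin 4 → ℝ) (dG : Fin 4 → Fin 4 → Fin 4 → Fin 4 → ℝ)
  (ddG : Fin 4 → Fin 4 → Fin 4 → Fin 4 → Fin 4 → ℝ)
  (X : Fin 4 → ℝ) (dX : Fin 4 → Fin 4 → ℝ) (ddX : Fin 4 → Fin 4 → Fin 4 → ℝ)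
  (dddX : Fin 4 → Fin 4 → Fin 4 → Fin 4 → ℝ)

/-- The deformation tensor in terms of the 1-jet `X`, `dX` of the covector field. -/
def jetDef (a b : Fin 4) : ℝ :=
  dX a b - ∑ e, G e a b * X e + (dX b a - ∑ e, G e b a * X e)

/-- The derivative `∂_d` of the deformation tensor in terms of jets. -/
def jetDDef (d a b : Fin 4) : ℝ :=
  ddX d a b - ∑ e, (dG d e a b * X e + G e a b * dX d e)
    + (ddX d b a - ∑ e, (dG d e b a * X e + G e b a * dX d e))

/-- The second derivative `∂_d ∂_d'` of the deformation tensor in terms of jets. -/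
def jetDDDef (d d' a b : Fin 4) : ℝ :=
  dddX d d' a b - ∑ e, (ddG d d' e a b * X e + dG d' e a b * dX d e
      + (dG d e a b * dX d' e + G e a b * ddX d d' e))
    + (dddX d d' b a - ∑ e, (ddG d d' e b a * X e + dG d' e b a * dX d e
      + (dG d e b a * dX d' e + G e b a * ddX d d' e)))

end Jets

variable {M : ℝ} {x : Fin 4 → ℝ} {X : Fin 4 → (Fin 4 → ℝ) → ℝ}

theorem deformation_symm (a b : Fin 4) : deformation M X a b = deformation M X b a :=
  funext fun _ => add_comm _ _

theorem deformation_eq_jet (hM : 0 < M) (hx : x ∈ exterior M) (a b : Fin 4) :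
    deformation M X a b x = jetDef (gamAt M x) (fun e => X e x) (fun a b => pd a (X b) x) a b := by
  simp only [deformation, cov₁, jetDef, christoffel_eq hM hx]

theorem smoothExt_deformation (hM : 0 < M) (hX : ∀ a, SmoothExt M (X a)) (a b : Fin 4) :
    SmoothExt M (deformation M X a b) := by
  have k : ∀ a b, SmoothExt M (cov₁ M X a b) := fun a b =>
    ((hX b).pd a).sub (.sum fun e _ => (smoothExt_christoffel hM e a b).mul (hX e))
  exact (k a b).add (k b a)

theorem pd_deformation (hM : 0 < M) (hX : ∀ a, SmoothExt M (X a)) (hx : x ∈ exterior M)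
    (d a b : Fin 4) :
    pd d (deformation M X a b) x = jetDDef (gamAt M x) (dgamAt M x) (fun e => X e x)
      (fun a b => pd a (X b) x) (fun d a b => pd d (pd a (X b)) x) d a b := by
  have k : ∀ e a b, SmoothExt M (fun y => gamAt M y e a b * X e y) :=
    fun e a b => (smoothExt_gamAt hM e a b).mul (hX e)
  have k' : ∀ a b, SmoothExt M (fun y => pd a (X b) y - ∑ e, gamAt M y e a b * X e y) :=
    fun a b => ((hX b).pd a).sub (.sum fun e _ => k e a b)
  rw [pd_congr (fun y hy => deformation_eq_jet hM hy a b) hx]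
  unfold jetDef
  rw [pd_add (k' a b) (k' b a) hx, pd_sub ((hX b).pd a) (.sum fun e _ => k e a b) hx,
    pd_sub ((hX a).pd b) (.sum fun e _ => k e b a) hx, pd_sum (fun e _ => k e a b) hx,
    pd_sum (fun e _ => k e b a) hx]
  simp only [pd_mul (smoothExt_gamAt hM _ _ _) (hX _) hx, pd_gamAt hM hx, jetDDef]

theorem pd_pd_deformation (hM : 0 < M) (hX : ∀ a, SmoothExt M (X a)) (hx : x ∈ exterior M)
    (d d' a b : Fin 4) :
    pd d (pd d' (deformation M X a b)) x = jetDDDef (gamAt M x) (dgamAt M x) (ddgamAt M x)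
      (fun e => X e x) (fun a b => pd a (X b) x) (fun d a b => pd d (pd a (X b)) x)
      (fun c d a b => pd c (pd d (pd a (X b))) x) d d' a b := by
  have k1 : ∀ e a b, SmoothExt M (fun y => dgamAt M y d' e a b * X e y) :=
    fun e a b => (smoothExt_dgamAt hM d' e a b).mul (hX e)
  have k2 : ∀ e a b, SmoothExt M (fun y => gamAt M y e a b * pd d' (X e) y) :=
    fun e a b => (smoothExt_gamAt hM e a b).mul ((hX e).pd d')
  have k : ∀ e a b, SmoothExt M (fun y => dgamAt M y d' e a b * X e y
      + gamAt M y e a b * pd d' (X e) y) := fun e a b => (k1 e a b).add (k2 e a b)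
  have k' : ∀ a b, SmoothExt M (fun y => pd d' (pd a (X b)) y - ∑ e, (dgamAt M y d' e a b * X e y
      + gamAt M y e a b * pd d' (X e) y)) :=
    fun a b => (((hX b).pd a).pd d').sub (.sum fun e _ => k e a b)
  rw [pd_congr (fun y hy => pd_deformation hM hX hy d' a b) hx]
  unfold jetDDef
  rw [pd_add (k' a b) (k' b a) hx, pd_sub (((hX b).pd a).pd d') (.sum fun e _ => k e a b) hx,
    pd_sub (((hX a).pd b).pd d') (.sum fun e _ => k e b a) hx, pd_sum (fun e _ => k e a b) hx,
    pd_sum (fun e _ => k e b a) hx]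
  simp only [pd_add (k1 _ _ _) (k2 _ _ _) hx, pd_mul (smoothExt_gamAt hM _ _ _) ((hX _).pd d') hx,
    pd_mul (smoothExt_dgamAt hM _ _ _ _) (hX _) hx, pd_gamAt hM hx, pd_dgamAt hM hx, jetDDDef]

section Algebra

-- One simp set serves all components, each of which uses only a part of it.
set_option linter.unusedSimpArgs false

variable {r D s c : ℝ} {X : Fin 4 → ℝ} {dX : Fin 4 → Fin 4 → ℝ} {ddX : Fin 4 → Fin 4 → Fin 4 → ℝ}
  {dddX : Fin 4 → Fin 4 → Fin 4 → Fin 4 → ℝ} {u : Fin 4 → Fin 4 → ℝ}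
  {du : Fin 4 → Fin 4 → Fin 4 → ℝ} {ddu : Fin 4 → Fin 4 → Fin 4 → Fin 4 → ℝ}

theorem jetRicci_zero_one_deformation (hr : r ≠ 0) (hD : D ≠ 0) (hs : s ≠ 0)
    (h2 : ∀ d a b, ddX d a b = ddX a d b)
    (h3 : ∀ e d a b, dddX e d a b = dddX d e a b) (h3' : ∀ e d a b, dddX e d a b = dddX e a d b)
    (hu : u = jetDef (gam r D s c) X dX) (hdu : du = jetDDef (gam r D s c) (dgam r D s c) X dX ddX)
    (hddu : ddu = jetDDDef (gam r D s c) (dgam r D s c) (ddgam r D s c) X dX ddX dddX)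
    (hj : IsSymmetricJet u du ddu) :
    jetRicci (ginv r D s) (gam r D s c) (dgam r D s c) u du ddu 0 1 = 0 := by
  rw [jetRicci_zero_one hr hD hs hj]
  subst hu hdu hddu
  simp only [jetDef, jetDDef, jetDDDef, Fin.sum_univ_four, gam, dgam, ddgam,
    Matrix.cons_val, Pi.zero_apply, zero_mul, mul_zero, add_zero, zero_add, sub_zero, zero_sub]
  simp only [h2 1 0, h2 2 0, h2 3 0, h2 2 1, h2 3 1, h2 3 2, h3 1 0, h3 2 0, h3 3 0, h3 2 1, h3 3 1,
    h3 3 2, h3' _ 1 0, h3' _ 2 0, h3' _ 3 0, h3' _ 2 1, h3' _ 3 1, h3' _ 3 2]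
  field_simp
  ring

theorem jetRicci_zero_two_deformation (hr : r ≠ 0) (hD : D ≠ 0) (hs : s ≠ 0)
    (hc : c ^ 2 = 1 - s ^ 2) (h2 : ∀ d a b, ddX d a b = ddX a d b)
    (h3 : ∀ e d a b, dddX e d a b = dddX d e a b) (h3' : ∀ e d a b, dddX e d a b = dddX e a d b)
    (hu : u = jetDef (gam r D s c) X dX) (hdu : du = jetDDef (gam r D s c) (dgam r D s c) X dX ddX)
    (hddu : ddu = jetDDDef (gam r D s c) (dgam r D s c) (ddgam r D s c) X dX ddX dddX)
    (hj : IsSymmetricJet u du ddu) :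
    jetRicci (ginv r D s) (gam r D s c) (dgam r D s c) u du ddu 0 2 = 0 := by
  rw [jetRicci_zero_two hr hD hs hj]
  subst hu hdu hddu
  simp only [jetDef, jetDDef, jetDDDef, Fin.sum_univ_four, gam, dgam, ddgam,
    Matrix.cons_val, Pi.zero_apply, zero_mul, mul_zero, add_zero, zero_add, sub_zero, zero_sub]
  simp only [h2 1 0, h2 2 0, h2 3 0, h2 2 1, h2 3 1, h2 3 2, h3 1 0, h3 2 0, h3 3 0, h3 2 1, h3 3 1,
    h3 3 2, h3' _ 1 0, h3' _ 2 0, h3' _ 3 0, h3' _ 2 1, h3' _ 3 1, h3' _ 3 2]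
  field_simp
  ring_nf
  simp only [hc]
  ring

theorem jetRicci_zero_three_deformation (hr : r ≠ 0) (hD : D ≠ 0) (hs : s ≠ 0)
    (hc : c ^ 2 = 1 - s ^ 2) (h2 : ∀ d a b, ddX d a b = ddX a d b)
    (h3 : ∀ e d a b, dddX e d a b = dddX d e a b) (h3' : ∀ e d a b, dddX e d a b = dddX e a d b)
    (hu : u = jetDef (gam r D s c) X dX) (hdu : du = jetDDef (gam r D s c) (dgam r D s c) X dX ddX)
    (hddu : ddu = jetDDDef (gam r D s c) (dgam r D s c) (ddgam r D s c) X dX ddX dddX)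
    (hj : IsSymmetricJet u du ddu) :
    jetRicci (ginv r D s) (gam r D s c) (dgam r D s c) u du ddu 0 3 = 0 := by
  rw [jetRicci_zero_three hr hD hs hj]
  subst hu hdu hddu
  simp only [jetDef, jetDDef, jetDDDef, Fin.sum_univ_four, gam, dgam, ddgam,
    Matrix.cons_val, Pi.zero_apply, zero_mul, mul_zero, add_zero, zero_add, sub_zero, zero_sub]
  simp only [h2 1 0, h2 2 0, h2 3 0, h2 2 1, h2 3 1, h2 3 2, h3 1 0, h3 2 0, h3 3 0, h3 2 1, h3 3 1,
    h3 3 2, h3' _ 1 0, h3' _ 2 0, h3' _ 3 0, h3' _ 2 1, h3' _ 3 1, h3' _ 3 2]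
  field_simp
  ring_nf
  simp only [hc]
  ring

set_option maxHeartbeats 2000000 in
theorem jetRicci_hamiltonian_deformation (hr : r ≠ 0) (hD : D ≠ 0) (hs : s ≠ 0)
    (hc : c ^ 2 = 1 - s ^ 2) (h2 : ∀ d a b, ddX d a b = ddX a d b)
    (h3 : ∀ e d a b, dddX e d a b = dddX d e a b) (h3' : ∀ e d a b, dddX e d a b = dddX e a d b)
    (hu : u = jetDef (gam r D s c) X dX) (hdu : du = jetDDef (gam r D s c) (dgam r D s c) X dX ddX)
    (hddu : ddu = jetDDDef (gam r D s c) (dgam r D s c) (ddgam r D s c) X dX ddX dddX)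
    (hj : IsSymmetricJet u du ddu) :
    r / D * jetRicci (ginv r D s) (gam r D s c) (dgam r D s c) u du ddu 0 0
      + D / r * jetRicci (ginv r D s) (gam r D s c) (dgam r D s c) u du ddu 1 1
      + 1 / r ^ 2 * jetRicci (ginv r D s) (gam r D s c) (dgam r D s c) u du ddu 2 2
      + 1 / (r ^ 2 * s ^ 2) * jetRicci (ginv r D s) (gam r D s c) (dgam r D s c) u du ddu 3 3
      = 0 := by
  rw [jetRicci_hamiltonian hr hD hs hc hj]
  subst hu hdu hddu
  simp only [jetDef, jetDDef, jetDDDef, Fin.sum_univ_four, gam, dgam, ddgam,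
    Matrix.cons_val, Pi.zero_apply, zero_mul, mul_zero, add_zero, zero_add, sub_zero, zero_sub]
  simp only [h2 1 0, h2 2 0, h2 3 0, h2 2 1, h2 3 1, h2 3 2, h3 1 0, h3 2 0, h3 3 0, h3 2 1, h3 3 1,
    h3 3 2, h3' _ 1 0, h3' _ 2 0, h3' _ 3 0, h3' _ 2 1, h3' _ 3 1, h3' _ 3 2]
  field_simp
  ring_nf
  simp only [hc]
  ring

end Algebra
end

noncomputable section

/-! ### Linearity, and the constraint components of a normalization -/

section Jets

variable {g : Fin 4 → ℝ} {G : Fin 4 → Fin 4 → Fin 4 → ℝ} {dG : Fin 4 → Fin 4 → Fin 4 → Fin 4 → ℝ}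
  {u v : Fin 4 → Fin 4 → ℝ} {du dv : Fin 4 → Fin 4 → Fin 4 → ℝ}
  {ddu ddv : Fin 4 → Fin 4 → Fin 4 → Fin 4 → ℝ}

theorem jetCov_sub (a b c : Fin 4) :
    jetCov G (u - v) (du - dv) a b c = jetCov G u du a b c - jetCov G v dv a b c := by
  simp only [jetCov, Pi.sub_apply, mul_sub, Finset.sum_sub_distrib]
  ring

theorem jetDCov_sub (d a b c : Fin 4) :
    jetDCov G dG (u - v) (du - dv) (ddu - ddv) d a b c
      = jetDCov G dG u du ddu d a b c - jetDCov G dG v dv ddv d a b c := by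
  simp only [jetDCov, Pi.sub_apply, mul_sub, Finset.sum_sub_distrib, Finset.sum_add_distrib]
  ring

theorem jetCovCov_sub (a b c d : Fin 4) :
    jetCovCov G dG (u - v) (du - dv) (ddu - ddv) a b c d
      = jetCovCov G dG u du ddu a b c d - jetCovCov G dG v dv ddv a b c d := by
  simp only [jetCovCov, jetDCov_sub, jetCov_sub, mul_sub, Finset.sum_sub_distrib]
  ring

theorem jetRicci_sub (b d : Fin 4) :
    jetRicci g G dG (u - v) (du - dv) (ddu - ddv) b d
      = jetRicci g G dG u du ddu b d - jetRicci g G dG v dv ddv b d := by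
  simp only [jetRicci, jetCovCov_sub]
  rw [← mul_sub, ← Finset.sum_sub_distrib]
  congr 1
  exact Finset.sum_congr rfl fun a _ => by ring

end Jets

variable {M : ℝ} {x : Fin 4 → ℝ}

theorem pd_pd_congr {f g : (Fin 4 → ℝ) → ℝ} (h : Set.EqOn f g (exterior M)) (hx : x ∈ exterior M)
    (a b : Fin 4) : pd a (pd b f) x = pd a (pd b g) x :=
  pd_congr (fun _ hy => pd_congr h hy b) hx a

/-- The linearized Ricci tensor of a difference, given only on the exterior. -/
theorem linRicci_eq_sub (hM : 0 < M) {h k w : Fin 4 → Fin 4 → (Fin 4 → ℝ) → ℝ}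
    (hk : ∀ a b, SmoothExt M (k a b)) (hw : ∀ a b, SmoothExt M (w a b))
    (heq : ∀ y ∈ exterior M, ∀ a b, h a b y = k a b y - w a b y) (hx : x ∈ exterior M)
    (b d : Fin 4) : linRicci M h b d x = linRicci M k b d x - linRicci M w b d x := by
  have e : ∀ a b, Set.EqOn (h a b) (fun y => k a b y - w a b y) (exterior M) :=
    fun a b y hy => heq y hy a b
  have hh : ∀ a b, SmoothExt M (h a b) := fun a b => ((hk a b).sub (hw a b)).congr (e a b)
  rw [linRicci_eq_jet hM hh hx, linRicci_eq_jet hM hk hx, linRicci_eq_jet hM hw hx,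
    ← jetRicci_sub]
  congr 1
  · funext b c; exact heq x hx b c
  · funext a b c
    exact (pd_congr (e b c) hx a).trans (pd_sub (hk b c) (hw b c) hx a)
  · funext d a b c
    rw [pd_pd_congr (e b c) hx, pd_congr (fun y hy => pd_sub (hk b c) (hw b c) hy a) hx,
      pd_sub ((hk b c).pd a) ((hw b c).pd a) hx]
    rfl

/-- The components of the vacuum constraint equations, relative to the slices of constant `t`, of a
two-tensor at `x`: the momentum constraints, and the Hamiltonian constraint, which is twice
`r / (r - 2M)` times the `tt` component of the linearized Einstein tensor. -/
structure ConstraintsAt (M : ℝ) (h : Fin 4 → Fin 4 → (Fin 4 → ℝ) → ℝ) (x : Fin 4 → ℝ) : Prop where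
  radial : linRicci M h 0 1 x = 0
  polar : linRicci M h 0 2 x = 0
  azimuthal : linRicci M h 0 3 x = 0
  hamiltonian : x 1 / (x 1 - 2 * M) * linRicci M h 0 0 x
    + (x 1 - 2 * M) / x 1 * linRicci M h 1 1 x + 1 / x 1 ^ 2 * linRicci M h 2 2 x
    + 1 / (x 1 ^ 2 * Real.sin (x 2) ^ 2) * linRicci M h 3 3 x = 0

theorem ConstraintsAt.sub (hM : 0 < M) {h k w : Fin 4 → Fin 4 → (Fin 4 → ℝ) → ℝ}
    (hk : ∀ a b, SmoothExt M (k a b)) (hw : ∀ a b, SmoothExt M (w a b))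
    (heq : ∀ y ∈ exterior M, ∀ a b, h a b y = k a b y - w a b y) (hx : x ∈ exterior M)
    (ck : ConstraintsAt M k x) (cw : ConstraintsAt M w x) : ConstraintsAt M h x := by
  constructor <;> simp only [linRicci_eq_sub hM hk hw heq hx]
  · rw [ck.radial, cw.radial, sub_zero]
  · rw [ck.polar, cw.polar, sub_zero]
  · rw [ck.azimuthal, cw.azimuthal, sub_zero]
  · linear_combination ck.hamiltonian - cw.hamiltonian

theorem SolvesLinearizedEinstein.constraintsAt (hM : 0 < M)
    {k : Fin 4 → Fin 4 → (Fin 4 → ℝ) → ℝ} (hk : SolvesLinearizedEinstein M k)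
    (hx : x ∈ exterior M) : ConstraintsAt M k x := by
  have off : ∀ a b, a ≠ b → linRicci M k a b x = 0 := fun a b hab => by
    simpa [linEinstein, metric, Matrix.diagonal_apply_ne _ hab] using hk x hx a b
  refine ⟨off 0 1 (by decide), off 0 2 (by decide), off 0 3 (by decide), ?_⟩
  have hr := (r_pos hM hx).ne'
  have hD := (D_pos hx).ne'
  have hs := (sin_pos_of_mem hx).ne'
  have h00 := hk x hx 0 0
  simp only [linEinstein, metric_inv_apply hM hx, ite_mul, zero_mul, Finset.sum_ite_eq,
    Finset.mem_univ, if_true] at h00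
  simp only [Fin.sum_univ_four, ginv, metric, Matrix.diagonal_apply_eq, Matrix.cons_val] at h00
  rw [show 1 - 2 * M / x 1 = (x 1 - 2 * M) / x 1 by field_simp] at h00
  have : 2 * (x 1 / (x 1 - 2 * M)) * 0 = (0 : ℝ) := mul_zero _
  rw [← this, ← h00]
  field_simp
  ring

/-- Deformation tensors satisfy the linearized constraint equations. -/
theorem constraintsAt_deformation (hM : 0 < M) {X : Fin 4 → (Fin 4 → ℝ) → ℝ}
    (hX : ∀ a, SmoothExt M (X a)) (hx : x ∈ exterior M) :
    ConstraintsAt M (deformation M X) x := by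
  have hr := (r_pos hM hx).ne'
  have hD := (D_pos hx).ne'
  have hs := (sin_pos_of_mem hx).ne'
  have hc : Real.cos (x 2) ^ 2 = 1 - Real.sin (x 2) ^ 2 := Real.cos_sq' _
  have hπ := smoothExt_deformation hM hX
  have hj := isSymmetricJet_of_smooth hπ deformation_symm hx
  have h2 : ∀ d a b, pd d (pd a (X b)) x = pd a (pd d (X b)) x :=
    fun d a b => pd_comm (hX b) hx d a
  have h3 : ∀ e d a b, pd e (pd d (pd a (X b))) x = pd d (pd e (pd a (X b))) x :=
    fun e d a b => pd_comm ((hX b).pd a) hx e d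
  have h3' : ∀ e d a b, pd e (pd d (pd a (X b))) x = pd e (pd a (pd d (X b))) x :=
    fun e d a b => pd_congr (fun y hy => pd_comm (hX b) hy d a) hx e
  have e0 : (fun b c => deformation M X b c x) = _ :=
    funext fun b => funext fun c => deformation_eq_jet (X := X) hM hx b c
  have e1 : (fun a b c => pd a (deformation M X b c) x) = _ :=
    funext fun a => funext fun b => funext fun c => pd_deformation hM hX hx a b c
  have e2 : (fun d a b c => pd d (pd a (deformation M X b c)) x) = _ :=
    funext fun d => funext fun a => funext fun b => funext fun c =>
      pd_pd_deformation hM hX hx d a b c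
  constructor <;> simp only [linRicci_eq_jet hM hπ hx]
  · exact jetRicci_zero_one_deformation hr hD hs h2 h3 h3' e0 e1 e2 hj
  · exact jetRicci_zero_two_deformation hr hD hs hc h2 h3 h3' e0 e1 e2 hj
  · exact jetRicci_zero_three_deformation hr hD hs hc h2 h3 h3' e0 e1 e2 hj
  · exact jetRicci_hamiltonian_deformation hr hD hs hc h2 h3 h3' e0 e1 e2 hj

end

noncomputable section

/-! ### The constraint equations in Chandrasekhar gauge -/

section Coefficients

variable {M : ℝ} {x : Fin 4 → ℝ}

theorem pd_comp_coord {φ : ℝ → ℝ} {φ' : ℝ} {i : Fin 4} (h : HasDerivAt φ φ' (x i)) (a : Fin 4) :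
    pd a (fun y => φ (y i)) x = if a = i then φ' else 0 := by
  have h1 : HasFDerivAt (fun y : Fin 4 → ℝ => y i)
      (ContinuousLinearMap.proj (R := ℝ) (φ := fun _ : Fin 4 => ℝ) i) x := hasFDerivAt_apply i x
  have h2 := h.comp_hasFDerivAt x h1
  have h3 : fderiv ℝ (fun y : Fin 4 → ℝ => φ (y i)) x = _ := h2.fderiv
  simp only [pd, h3]
  by_cases hai : a = i
  · subst hai; simp
  · simp [hai, Ne.symm hai]

/-- The cotangent of the polar angle. -/
def cotθ (x : Fin 4 → ℝ) : ℝ := Real.cos (x 2) / Real.sin (x 2)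

/-- The squared cosecant of the polar angle. -/
def cscSq (x : Fin 4 → ℝ) : ℝ := 1 / Real.sin (x 2) ^ 2

/-- The squared sine of the polar angle. -/
def sinSq (x : Fin 4 → ℝ) : ℝ := Real.sin (x 2) ^ 2

theorem smoothExt_cotθ : SmoothExt M cotθ :=
  ContDiffOn.div smoothExt_cos smoothExt_sin fun _ hy => (sin_pos_of_mem hy).ne'

theorem smoothExt_sinSq : SmoothExt M sinSq := ContDiffOn.pow smoothExt_sin 2

theorem smoothExt_cscSq : SmoothExt M cscSq :=
  ContDiffOn.div contDiffOn_const smoothExt_sinSq fun _ hy => pow_ne_zero 2 (sin_pos_of_mem hy).ne'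

theorem pd_cotθ (hx : x ∈ exterior M) (a : Fin 4) :
    pd a cotθ x = if a = 2 then -cscSq x else 0 := by
  refine pd_comp_coord (φ := fun t => Real.cos t / Real.sin t) ?_ a
  have hs := (sin_pos_of_mem hx).ne'
  refine ((Real.hasDerivAt_cos _).div (Real.hasDerivAt_sin _) hs).congr_deriv ?_
  rw [cscSq]
  field_simp
  linarith [Real.sin_sq_add_cos_sq (x 2)]

theorem pd_sinSq (a : Fin 4) :
    pd a sinSq x = if a = 2 then 2 * Real.sin (x 2) * Real.cos (x 2) else 0 := by
  refine pd_comp_coord (φ := fun t => Real.sin t ^ 2) ?_ a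
  exact ((Real.hasDerivAt_sin _).pow 2).congr_deriv (by simp)

theorem pd_cscSq (hx : x ∈ exterior M) (a : Fin 4) :
    pd a cscSq x = if a = 2 then -2 * cotθ x * cscSq x else 0 := by
  refine pd_comp_coord (φ := fun t => 1 / Real.sin t ^ 2) ?_ a
  have hs := (sin_pos_of_mem hx).ne'
  refine ((hasDerivAt_const _ (1 : ℝ)).div ((Real.hasDerivAt_sin _).pow 2)
    (pow_ne_zero 2 hs)).congr_deriv ?_
  simp only [cscSq, cotθ, Pi.pow_apply]
  field_simp
  ring

theorem cscSq_eq (hx : x ∈ exterior M) : cscSq x = 1 + cotθ x ^ 2 := by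
  have hs := (sin_pos_of_mem hx).ne'
  rw [cscSq, cotθ]
  field_simp
  linarith [Real.sin_sq_add_cos_sq (x 2)]

end Coefficients

/-- The two-tensor `A dt² + B dr² + (H + N) dθ² + 2 C dθ dφ + sin² θ (H - N) dφ²`, to which a closed
tensor reduces in Chandrasekhar gauge. -/
def blockTensor (A B H N C : (Fin 4 → ℝ) → ℝ) (a b : Fin 4) : (Fin 4 → ℝ) → ℝ :=
  ![![A, fun _ => 0, fun _ => 0, fun _ => 0],
    ![fun _ => 0, B, fun _ => 0, fun _ => 0],
    ![fun _ => 0, fun _ => 0, fun y => H y + N y, C],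
    ![fun _ => 0, fun _ => 0, C, fun y => sinSq y * (H y - N y)]] a b

/-- The quantity conserved by the radial momentum constraint and, where `𝓛(h) = 0`, by the
Hamiltonian constraint, with `h₁₁ = B`. In terms of `L = ½ (1 - 2M/r) B` and `T = H / (2r²)` it is
`(r - 2M)(L - T) - r (r - 2M) T_r + M T`. -/
def radialConstraint (M : ℝ) (B H : (Fin 4 → ℝ) → ℝ) (y : Fin 4 → ℝ) : ℝ :=
  (y 1 - 2 * M) ^ 2 / (2 * y 1) * B y - (y 1 - 2 * M) / (2 * y 1) * pd 1 H y
    + (y 1 - M) / (2 * y 1 ^ 2) * H y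

/-- The constraint operator `𝓛` with `P = ½ Δ̊H₂ + H₂` and `B = h₁₁`. -/
def angularConstraint (M : ℝ) (B H P : (Fin 4 → ℝ) → ℝ) (y : Fin 4 → ℝ) : ℝ :=
  P y - H y - (y 1 ^ 2 - 2 * M * y 1) * B y

variable {M : ℝ} {x : Fin 4 → ℝ} {A B H N C P : (Fin 4 → ℝ) → ℝ}

theorem blockTensor_symm (a b : Fin 4) : blockTensor A B H N C a b = blockTensor A B H N C b a := by
  fin_cases a <;> fin_cases b <;> rfl

theorem smoothExt_blockTensor (hA : SmoothExt M A) (hB : SmoothExt M B) (hH : SmoothExt M H)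
    (hN : SmoothExt M N) (hC : SmoothExt M C) (a b : Fin 4) :
    SmoothExt M (blockTensor A B H N C a b) := by
  fin_cases a <;> fin_cases b <;>
    first | exact .const 0 | exact hA | exact hB | exact hC | exact hH.add hN |
      exact smoothExt_sinSq.mul (hH.sub hN)

theorem pd_radialConstraint_coeff₁ (hr : x 1 ≠ 0) (a : Fin 4) :
    pd a (fun y => (y 1 - 2 * M) ^ 2 / (2 * y 1)) x
      = if a = 1 then (x 1 - 2 * M) * (x 1 + 2 * M) / (2 * x 1 ^ 2) else 0 := by
  refine pd_comp_coord (φ := fun t => (t - 2 * M) ^ 2 / (2 * t)) ?_ a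
  refine ((((hasDerivAt_id' (x 1)).sub_const (2 * M)).pow 2).div
    ((hasDerivAt_id' (x 1)).const_mul 2) (by simp [hr])).congr_deriv ?_
  simp only [Pi.pow_apply]
  field_simp
  push_cast
  ring

theorem pd_radialConstraint_coeff₂ (hr : x 1 ≠ 0) (a : Fin 4) :
    pd a (fun y => (y 1 - 2 * M) / (2 * y 1)) x
      = if a = 1 then M / x 1 ^ 2 else 0 := by
  refine pd_comp_coord (φ := fun t => (t - 2 * M) / (2 * t)) ?_ a
  refine (((hasDerivAt_id' (x 1)).sub_const (2 * M)).div
    ((hasDerivAt_id' (x 1)).const_mul 2) (by simp [hr])).congr_deriv ?_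
  field_simp
  ring

theorem pd_radialConstraint_coeff₃ (hr : x 1 ≠ 0) (a : Fin 4) :
    pd a (fun y => (y 1 - M) / (2 * y 1 ^ 2)) x
      = if a = 1 then (2 * M - x 1) / (2 * x 1 ^ 3) else 0 := by
  refine pd_comp_coord (φ := fun t => (t - M) / (2 * t ^ 2)) ?_ a
  refine (((hasDerivAt_id' (x 1)).sub_const M).div
    (((hasDerivAt_id' (x 1)).pow 2).const_mul 2) (by simp [hr])).congr_deriv ?_
  simp only [Pi.pow_apply]
  field_simp
  push_cast
  ring

theorem smoothExt_radialConstraint_coeff (hM : 0 < M) :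
    SmoothExt M (fun y => (y 1 - 2 * M) ^ 2 / (2 * y 1)) ∧
      SmoothExt M (fun y => (y 1 - 2 * M) / (2 * y 1)) ∧
      SmoothExt M (fun y => (y 1 - M) / (2 * y 1 ^ 2)) := by
  have hr : ∀ y ∈ exterior M, 2 * y 1 ≠ 0 := fun y hy => by simp [(r_pos hM hy).ne']
  have hr2 : ∀ y ∈ exterior M, 2 * y 1 ^ 2 ≠ 0 := fun y hy => by simp [(r_pos hM hy).ne']
  have h1 : ContDiffOn ℝ ∞ (fun y : Fin 4 → ℝ => y 1) (exterior M) := smoothExt_r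
  exact ⟨((h1.sub contDiffOn_const).pow 2).div (contDiffOn_const.mul h1) hr,
    (h1.sub contDiffOn_const).div (contDiffOn_const.mul h1) hr,
    (h1.sub contDiffOn_const).div (contDiffOn_const.mul (h1.pow 2)) hr2⟩

theorem smoothExt_radialConstraint (hM : 0 < M) (hB : SmoothExt M B) (hH : SmoothExt M H) :
    SmoothExt M (radialConstraint M B H) := by
  obtain ⟨k1, k2, k3⟩ := smoothExt_radialConstraint_coeff hM
  exact ((k1.mul hB).sub (k2.mul (hH.pd 1))).add (k3.mul hH)

theorem pd_radialConstraint (hM : 0 < M) (hB : SmoothExt M B) (hH : SmoothExt M H)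
    (hx : x ∈ exterior M) (a : Fin 4) :
    pd a (radialConstraint M B H) x =
      (if a = 1 then (x 1 - 2 * M) * (x 1 + 2 * M) / (2 * x 1 ^ 2) else 0) * B x
      + (x 1 - 2 * M) ^ 2 / (2 * x 1) * pd a B x
      - ((if a = 1 then M / x 1 ^ 2 else 0) * pd 1 H x
        + (x 1 - 2 * M) / (2 * x 1) * pd a (pd 1 H) x)
      + ((if a = 1 then (2 * M - x 1) / (2 * x 1 ^ 3) else 0) * H x
        + (x 1 - M) / (2 * x 1 ^ 2) * pd a H x) := by
  obtain ⟨k1, k2, k3⟩ := smoothExt_radialConstraint_coeff hM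
  have hr := (r_pos hM hx).ne'
  unfold radialConstraint
  rw [pd_add ((k1.mul hB).sub (k2.mul (hH.pd 1))) (k3.mul hH) hx,
    pd_sub (k1.mul hB) (k2.mul (hH.pd 1)) hx, pd_mul k1 hB hx, pd_mul k2 (hH.pd 1) hx,
    pd_mul k3 hH hx, pd_radialConstraint_coeff₁ hr, pd_radialConstraint_coeff₂ hr,
    pd_radialConstraint_coeff₃ hr]

theorem smoothExt_angularCoeff : SmoothExt M (fun y => y 1 ^ 2 - 2 * M * y 1) :=
  ContDiffOn.sub (ContDiffOn.pow smoothExt_r 2) (contDiffOn_const.mul smoothExt_r)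

theorem pd_angularCoeff {a : Fin 4} (ha : a ≠ 1) :
    pd a (fun y => y 1 ^ 2 - 2 * M * y 1) x = 0 := by
  rw [pd_comp_coord (φ := fun t => t ^ 2 - 2 * M * t) (φ' := 2 * x 1 - 2 * M), if_neg ha]
  exact (((hasDerivAt_id' (x 1)).pow 2).sub ((hasDerivAt_id' (x 1)).const_mul (2 * M))).congr_deriv
    (by simp)

theorem smoothExt_angularConstraint (hB : SmoothExt M B) (hH : SmoothExt M H)
    (hP : SmoothExt M P) : SmoothExt M (angularConstraint M B H P) :=
  (hP.sub hH).sub (smoothExt_angularCoeff.mul hB)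

theorem pd_angularConstraint (hB : SmoothExt M B) (hH : SmoothExt M H) (hP : SmoothExt M P)
    (hx : x ∈ exterior M) {a : Fin 4} (ha : a ≠ 1) :
    pd a (angularConstraint M B H P) x = angularConstraint M (pd a B) (pd a H) (pd a P) x := by
  unfold angularConstraint
  rw [pd_sub (hP.sub hH) (smoothExt_angularCoeff.mul hB) hx, pd_sub hP hH hx,
    pd_mul smoothExt_angularCoeff hB hx, pd_angularCoeff ha]
  ring

theorem pd_pd_angularConstraint (hB : SmoothExt M B) (hH : SmoothExt M H) (hP : SmoothExt M P)
    (hx : x ∈ exterior M) {a b : Fin 4} (ha : a ≠ 1) (hb : b ≠ 1) :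
    pd a (pd b (angularConstraint M B H P)) x
      = angularConstraint M (pd a (pd b B)) (pd a (pd b H)) (pd a (pd b P)) x := by
  rw [pd_congr (fun y hy => pd_angularConstraint hB hH hP hy hb) hx,
    pd_angularConstraint (hB.pd b) (hH.pd b) (hP.pd b) hx ha]

theorem pd_sinSq_mul {K : (Fin 4 → ℝ) → ℝ} (hK : SmoothExt M K) (hx : x ∈ exterior M)
    {a : Fin 4} (ha : a ≠ 2) : pd a (fun y => sinSq y * K y) x = sinSq x * pd a K x := by
  rw [pd_mul smoothExt_sinSq hK hx, pd_sinSq, if_neg ha, zero_mul, zero_add]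

theorem pd_θ_sinSq_mul {K : (Fin 4 → ℝ) → ℝ} (hK : SmoothExt M K) (hx : x ∈ exterior M) :
    pd 2 (fun y => sinSq y * K y) x
      = 2 * (Real.sin (x 2) * Real.cos (x 2)) * K x + sinSq x * pd 2 K x := by
  rw [pd_mul smoothExt_sinSq hK hx, pd_sinSq, if_pos rfl]; ring

theorem pd_θθ_sinSq_mul {K : (Fin 4 → ℝ) → ℝ} (hK : SmoothExt M K) (hx : x ∈ exterior M) :
    pd 2 (pd 2 (fun y => sinSq y * K y)) x
      = 2 * (Real.cos (x 2) ^ 2 - Real.sin (x 2) ^ 2) * K x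
        + 4 * (Real.sin (x 2) * Real.cos (x 2)) * pd 2 K x + sinSq x * pd 2 (pd 2 K) x := by
  have k : SmoothExt M (fun y => 2 * (Real.sin (y 2) * Real.cos (y 2))) :=
    (SmoothExt.const 2).mul (smoothExt_sin.mul smoothExt_cos)
  have k' : pd 2 (fun y => 2 * (Real.sin (y 2) * Real.cos (y 2))) x
      = 2 * (Real.cos (x 2) ^ 2 - Real.sin (x 2) ^ 2) := by
    rw [pd_comp_coord (φ := fun t => 2 * (Real.sin t * Real.cos t)), if_pos rfl]
    exact (((Real.hasDerivAt_sin (x 2)).mul (Real.hasDerivAt_cos (x 2))).const_mul 2).congr_deriv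
      (by ring)
  rw [pd_congr (fun y hy => pd_θ_sinSq_mul hK hy) hx,
    pd_add (k.mul hK) (smoothExt_sinSq.mul (hK.pd 2)) hx, pd_mul k hK hx, k',
    pd_θ_sinSq_mul (hK.pd 2) hx]
  ring

/-- The divergence on the unit sphere of the trace-free tensor with components `N dθ²`,
`-N sin² θ dφ²` and `2 C dθ dφ` is the gradient of `P`. -/
structure SphereDivergence (M : ℝ) (N C P : (Fin 4 → ℝ) → ℝ) : Prop where
  polar : ∀ x ∈ exterior M, pd 2 N x + 2 * (cotθ x * N x) + cscSq x * pd 3 C x = pd 2 P x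
  azimuthal : ∀ x ∈ exterior M, pd 2 C x + cotθ x * C x - pd 3 N x = pd 3 P x

theorem SphereDivergence.pd_polar (h : SphereDivergence M N C P) (hN : SmoothExt M N)
    (hC : SmoothExt M C) (hx : x ∈ exterior M) (a : Fin 4) :
    pd a (pd 2 N) x + 2 * ((if a = 2 then -cscSq x else 0) * N x + cotθ x * pd a N x)
      + ((if a = 2 then -2 * cotθ x * cscSq x else 0) * pd 3 C x + cscSq x * pd a (pd 3 C) x)
      = pd a (pd 2 P) x := by
  have k1 := (smoothExt_cotθ (M := M)).mul hN
  have k2 := (SmoothExt.const (M := M) 2).mul k1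
  have k3 := (smoothExt_cscSq (M := M)).mul (hC.pd 3)
  rw [← pd_congr h.polar hx a, pd_add ((hN.pd 2).add k2) k3 hx, pd_add (hN.pd 2) k2 hx,
    pd_mul (.const 2) k1 hx, pd_mul smoothExt_cotθ hN hx, pd_mul smoothExt_cscSq (hC.pd 3) hx,
    pd_const, pd_cotθ hx, pd_cscSq hx]
  ring

theorem SphereDivergence.pd_azimuthal (h : SphereDivergence M N C P) (hN : SmoothExt M N)
    (hC : SmoothExt M C) (hx : x ∈ exterior M) {a : Fin 4} (ha : a ≠ 2) :
    pd a (pd 2 C) x + cotθ x * pd a C x - pd a (pd 3 N) x = pd a (pd 3 P) x := by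
  have k1 := (smoothExt_cotθ (M := M)).mul hC
  rw [← pd_congr h.azimuthal hx a, pd_sub ((hC.pd 2).add k1) (hN.pd 3) hx, pd_add (hC.pd 2) k1 hx,
    pd_mul smoothExt_cotθ hC hx, pd_cotθ hx, if_neg ha]
  ring

/-- The radial momentum constraint is a total `t` derivative. -/
theorem linRicci_zero_one_blockTensor (hM : 0 < M) (hA : SmoothExt M A) (hB : SmoothExt M B)
    (hH : SmoothExt M H) (hN : SmoothExt M N) (hC : SmoothExt M C) (hx : x ∈ exterior M) :
    linRicci M (blockTensor A B H N C) 0 1 x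
      = 2 / (x 1 * (x 1 - 2 * M)) * pd 0 (radialConstraint M B H) x := by
  have hr := (r_pos hM hx).ne'
  have hD := (D_pos hx).ne'
  have hs := (sin_pos_of_mem hx).ne'
  have hsm := smoothExt_blockTensor hA hB hH hN hC
  rw [linRicci_eq_jet hM hsm hx,
    jetRicci_zero_one hr hD hs (isSymmetricJet_of_smooth hsm blockTensor_symm hx),
    pd_radialConstraint hM hB hH hx]
  have e0 : ∀ a, pd a (fun _ : Fin 4 → ℝ => (0 : ℝ)) = fun _ => 0 :=
    fun a => funext fun _ => pd_const 0 a
  simp only [blockTensor, Matrix.cons_val, e0]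
  rw [pd_add hH hN hx, pd_sinSq_mul (hH.sub hN) hx (by decide), pd_sub hH hN hx,
    pd_congr (fun y hy => pd_add hH hN hy 1) hx, pd_add (hH.pd 1) (hN.pd 1) hx,
    pd_congr (fun y hy => pd_sinSq_mul (hH.sub hN) hy (a := 1) (by decide)) hx,
    pd_sinSq_mul ((hH.sub hN).pd 1) hx (by decide),
    pd_congr (fun y hy => pd_sub hH hN hy 1) hx, pd_sub (hH.pd 1) (hN.pd 1) hx]
  simp only [zero_ne_one, if_false, sinSq]
  field_simp
  ring

/-- The angular momentum constraints are the gradient of `∂_t 𝓛` along the spheres. -/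
theorem linRicci_zero_two_blockTensor (hM : 0 < M) (hA : SmoothExt M A) (hB : SmoothExt M B)
    (hH : SmoothExt M H) (hN : SmoothExt M N) (hC : SmoothExt M C) (hP : SmoothExt M P)
    (hdiv : SphereDivergence M N C P) (hx : x ∈ exterior M) :
    linRicci M (blockTensor A B H N C) 0 2 x
      = 1 / (2 * x 1 ^ 2) * pd 0 (pd 2 (angularConstraint M B H P)) x := by
  have hr := (r_pos hM hx).ne'
  have hD := (D_pos hx).ne'
  have hs := (sin_pos_of_mem hx).ne'
  have hsm := smoothExt_blockTensor hA hB hH hN hC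
  rw [linRicci_eq_jet hM hsm hx,
    jetRicci_zero_two hr hD hs (isSymmetricJet_of_smooth hsm blockTensor_symm hx),
    pd_pd_angularConstraint hB hH hP hx (by decide) (by decide), angularConstraint,
    ← hdiv.pd_polar hN hC hx]
  have e0 : ∀ a, pd a (fun _ : Fin 4 → ℝ => (0 : ℝ)) = fun _ => 0 :=
    fun a => funext fun _ => pd_const 0 a
  simp only [blockTensor, Matrix.cons_val, e0]
  rw [pd_add hH hN hx, pd_sinSq_mul (hH.sub hN) hx (by decide), pd_sub hH hN hx,
    pd_comm (smoothExt_sinSq.mul (hH.sub hN)) hx 0 2,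
    pd_congr (fun y hy => pd_sinSq_mul (hH.sub hN) hy (a := 0) (by decide)) hx,
    pd_θ_sinSq_mul ((hH.sub hN).pd 0) hx,
    pd_congr (fun y hy => pd_sub hH hN hy 0) hx, pd_sub (hH.pd 0) (hN.pd 0) hx,
    pd_sub hH hN hx, pd_comm hH hx 0 2, pd_comm hN hx 0 2]
  simp only [Fin.reduceEq, if_false, sinSq, cotθ, cscSq]
  field_simp
  ring

theorem linRicci_zero_three_blockTensor (hM : 0 < M) (hA : SmoothExt M A) (hB : SmoothExt M B)
    (hH : SmoothExt M H) (hN : SmoothExt M N) (hC : SmoothExt M C) (hP : SmoothExt M P)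
    (hdiv : SphereDivergence M N C P) (hx : x ∈ exterior M) :
    linRicci M (blockTensor A B H N C) 0 3 x
      = 1 / (2 * x 1 ^ 2) * pd 0 (pd 3 (angularConstraint M B H P)) x := by
  have hr := (r_pos hM hx).ne'
  have hD := (D_pos hx).ne'
  have hs := (sin_pos_of_mem hx).ne'
  have hsm := smoothExt_blockTensor hA hB hH hN hC
  rw [linRicci_eq_jet hM hsm hx,
    jetRicci_zero_three hr hD hs (isSymmetricJet_of_smooth hsm blockTensor_symm hx),
    pd_pd_angularConstraint hB hH hP hx (by decide) (by decide), angularConstraint,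
    ← hdiv.pd_azimuthal hN hC hx (by decide)]
  have e0 : ∀ a, pd a (fun _ : Fin 4 → ℝ => (0 : ℝ)) = fun _ => 0 :=
    fun a => funext fun _ => pd_const 0 a
  simp only [blockTensor, Matrix.cons_val, e0]
  rw [pd_congr (fun y hy => pd_add hH hN hy 3) hx, pd_add (hH.pd 3) (hN.pd 3) hx]
  simp only [cotθ]
  field_simp
  ring

/-- The Hamiltonian constraint is the sum of a total `r` derivative and of `Δ̊𝓛`. -/
theorem hamiltonian_blockTensor (hM : 0 < M) (hA : SmoothExt M A) (hB : SmoothExt M B)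
    (hH : SmoothExt M H) (hN : SmoothExt M N) (hC : SmoothExt M C) (hP : SmoothExt M P)
    (hdiv : SphereDivergence M N C P) (hx : x ∈ exterior M) :
    x 1 / (x 1 - 2 * M) * linRicci M (blockTensor A B H N C) 0 0 x
      + (x 1 - 2 * M) / x 1 * linRicci M (blockTensor A B H N C) 1 1 x
      + 1 / x 1 ^ 2 * linRicci M (blockTensor A B H N C) 2 2 x
      + 1 / (x 1 ^ 2 * Real.sin (x 2) ^ 2) * linRicci M (blockTensor A B H N C) 3 3 x
      = 4 / x 1 ^ 2 * pd 1 (radialConstraint M B H) x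
        + 1 / x 1 ^ 4 * (pd 2 (pd 2 (angularConstraint M B H P)) x
          + cscSq x * pd 3 (pd 3 (angularConstraint M B H P)) x
          + cotθ x * pd 2 (angularConstraint M B H P) x) := by
  have hr := (r_pos hM hx).ne'
  have hD := (D_pos hx).ne'
  have hs := (sin_pos_of_mem hx).ne'
  have hsm := smoothExt_blockTensor hA hB hH hN hC
  have hc : Real.cos (x 2) ^ 2 = 1 - Real.sin (x 2) ^ 2 := Real.cos_sq' _
  simp only [linRicci_eq_jet hM hsm hx]
  rw [jetRicci_hamiltonian hr hD hs hc (isSymmetricJet_of_smooth hsm blockTensor_symm hx),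
    pd_pd_angularConstraint hB hH hP hx (by decide) (by decide),
    pd_pd_angularConstraint hB hH hP hx (by decide) (by decide),
    pd_angularConstraint hB hH hP hx (by decide), pd_radialConstraint hM hB hH hx]
  simp only [angularConstraint]
  rw [← hdiv.pd_polar hN hC hx, ← hdiv.pd_azimuthal hN hC hx (by decide), ← hdiv.polar x hx]
  have e0 : ∀ a, pd a (fun _ : Fin 4 → ℝ => (0 : ℝ)) = fun _ => 0 :=
    fun a => funext fun _ => pd_const 0 a
  simp only [blockTensor, Matrix.cons_val, e0]
  have hK := hH.sub hN
  have s1 : ∀ a, pd a (fun y => H y - N y) x = pd a H x - pd a N x := fun a => pd_sub hH hN hx a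
  have s2 : ∀ a, pd a (pd a (fun y => H y - N y)) x = pd a (pd a H) x - pd a (pd a N) x :=
    fun a => by rw [pd_congr (fun y hy => pd_sub hH hN hy a) hx, pd_sub (hH.pd a) (hN.pd a) hx]
  have a1 : ∀ a, pd a (fun y => H y + N y) x = pd a H x + pd a N x := fun a => pd_add hH hN hx a
  have a2 : ∀ a, pd a (pd a (fun y => H y + N y)) x = pd a (pd a H) x + pd a (pd a N) x :=
    fun a => by rw [pd_congr (fun y hy => pd_add hH hN hy a) hx, pd_add (hH.pd a) (hN.pd a) hx]
  rw [pd_θθ_sinSq_mul hK hx, pd_θ_sinSq_mul hK hx, pd_sinSq_mul hK hx (a := 1) (by decide),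
    pd_congr (fun y hy => pd_sinSq_mul hK hy (a := 1) (by decide)) hx,
    pd_sinSq_mul (hK.pd 1) hx (by decide), pd_comm hC hx 3 2]
  simp only [s1, s2, a1, a2, if_true, sinSq, cotθ, cscSq, hc]
  field_simp
  ring_nf
  simp only [hc]
  ring

end

noncomputable section

/-! ### Closed tensors in Chandrasekhar gauge -/

theorem contMDiff_sphPt {E : Type*} [NormedAddCommGroup E] [NormedSpace ℝ E] {u v : E → ℝ}
    (hu : ContDiff ℝ ∞ u) (hv : ContDiff ℝ ∞ v) :
    ContMDiff 𝓘(ℝ, E) (𝓡 2) ∞ (fun y => sphPt (u y) (v y)) := by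
  have : Fact (Module.finrank ℝ (EuclideanSpace ℝ (Fin 3)) = 2 + 1) :=
    ⟨finrank_euclideanSpace_fin⟩
  have hsm : ContDiff ℝ ∞ fun y => (sphPt (u y) (v y) : EuclideanSpace ℝ (Fin 3)) := by
    rw [contDiff_euclidean]
    intro i
    fin_cases i
    · exact (Real.contDiff_sin.comp hu).mul (Real.contDiff_cos.comp hv)
    · exact (Real.contDiff_sin.comp hu).mul (Real.contDiff_sin.comp hv)
    · exact Real.contDiff_cos.comp hu
  exact ContMDiff.codRestrict_sphere hsm.contMDiff fun y => (sphPt (u y) (v y)).2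

/-- Smooth functions on the exterior remain smooth when composed with a smooth map into spherical
coordinates, including at the poles. -/
theorem SmoothFld.contDiffOn_comp {M : ℝ} {f : Fld} (hf : SmoothFld M f) {E : Type*}
    [NormedAddCommGroup E] [NormedSpace ℝ E] {t r θ φ : E → ℝ} (ht : ContDiff ℝ ∞ t)
    (hr : ContDiff ℝ ∞ r) (hθ : ContDiff ℝ ∞ θ) (hφ : ContDiff ℝ ∞ φ) :
    ContDiffOn ℝ ∞ (fun y => f ((t y, r y), sphPt (θ y) (φ y))) {y | 2 * M < r y} := by
  rw [← contMDiffOn_iff_contDiffOn]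
  have h1 : ContMDiff 𝓘(ℝ, E) (𝓘(ℝ, ℝ × ℝ).prod (𝓡 2)) ∞
      (fun y => ((t y, r y), sphPt (θ y) (φ y))) :=
    (ht.prodMk hr).contMDiff.prodMk (contMDiff_sphPt hθ hφ)
  exact hf.comp h1.contMDiffOn fun y hy => hy

theorem SmoothFld.smoothExt {M : ℝ} {f : Fld} (hf : SmoothFld M f) : SmoothExt M f.pull :=
  (hf.contDiffOn_comp (contDiff_apply ℝ ℝ (0 : Fin 4)) (contDiff_apply ℝ ℝ 1)
    (contDiff_apply ℝ ℝ 2) (contDiff_apply ℝ ℝ 3)).mono fun _ hy => hy.1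

variable {M : ℝ} {x : Fin 4 → ℝ} {F : (Fin 4 → ℝ) → ℝ}

theorem smoothExt_hessθθ (hF : SmoothExt M F) : SmoothExt M (hessθθ F) := (hF.pd 2).pd 2

theorem smoothExt_hessθφ (hF : SmoothExt M F) : SmoothExt M (hessθφ F) :=
  ((hF.pd 3).pd 2).sub (smoothExt_cotθ.mul (hF.pd 3))

theorem smoothExt_hessφφ (hF : SmoothExt M F) : SmoothExt M (hessφφ F) :=
  ((hF.pd 3).pd 3).add ((smoothExt_sin.mul smoothExt_cos).mul (hF.pd 2))

theorem sphLap_eq (hx : x ∈ exterior M) :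
    sphLap F x = pd 2 (pd 2 F) x + cscSq x * pd 3 (pd 3 F) x + cotθ x * pd 2 F x := by
  have hs := (sin_pos_of_mem hx).ne'
  simp only [sphLap, hessθθ, hessφφ, cscSq, cotθ]
  field_simp
  ring

theorem smoothExt_sphLap (hF : SmoothExt M F) : SmoothExt M (sphLap F) :=
  (((hF.pd 2).pd 2).add (smoothExt_cscSq.mul ((hF.pd 3).pd 3)) |>.add
    (smoothExt_cotθ.mul (hF.pd 2))).congr fun _ hy => sphLap_eq hy

/-- The trace-free part of the `θθ` component of the spherical Hessian. -/
def tracefreeHess (F : (Fin 4 → ℝ) → ℝ) (y : Fin 4 → ℝ) : ℝ :=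
  1 / 2 * (pd 2 (pd 2 F) y - cscSq y * pd 3 (pd 3 F) y - cotθ y * pd 2 F y)

theorem smoothExt_tracefreeHess (hF : SmoothExt M F) : SmoothExt M (tracefreeHess F) :=
  (SmoothExt.const (1 / 2)).mul ((((hF.pd 2).pd 2).sub (smoothExt_cscSq.mul ((hF.pd 3).pd 3))).sub
    (smoothExt_cotθ.mul (hF.pd 2)))

/-- The divergence of the trace-free Hessian of `F` on the unit sphere is `∇̊(½ Δ̊F + F)`, the
zeroth order term coming from the Ricci curvature of the sphere. -/
theorem sphereDivergence_tracefreeHess (hF : SmoothExt M F) :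
    SphereDivergence M (tracefreeHess F) (hessθφ F) (fun y => 1 / 2 * sphLap F y + F y) := by
  have h2 := hF.pd 2
  have h3 := hF.pd 3
  have h22 := h2.pd 2
  have h33 := h3.pd 3
  have h23 := h3.pd 2
  have c1 := (smoothExt_cscSq (M := M)).mul h33
  have c2 := (smoothExt_cotθ (M := M)).mul h2
  have c3 := (smoothExt_cotθ (M := M)).mul h3
  have dN : ∀ y ∈ exterior M, ∀ a, pd a (tracefreeHess F) y = 1 / 2 * (pd a (pd 2 (pd 2 F)) y
      - ((if a = 2 then -2 * cotθ y * cscSq y else 0) * pd 3 (pd 3 F) y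
        + cscSq y * pd a (pd 3 (pd 3 F)) y)
      - ((if a = 2 then -cscSq y else 0) * pd 2 F y + cotθ y * pd a (pd 2 F) y)) := by
    intro y hy a
    unfold tracefreeHess
    rw [pd_mul (.const _) ((h22.sub c1).sub c2) hy, pd_sub (h22.sub c1) c2 hy, pd_sub h22 c1 hy,
      pd_mul smoothExt_cscSq h33 hy, pd_mul smoothExt_cotθ h2 hy, pd_cotθ hy, pd_cscSq hy, pd_const]
    ring
  have dC : ∀ y ∈ exterior M, ∀ a, pd a (hessθφ F) y = pd a (pd 2 (pd 3 F)) y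
      - ((if a = 2 then -cscSq y else 0) * pd 3 F y + cotθ y * pd a (pd 3 F) y) := by
    intro y hy a
    rw [← pd_cotθ hy, ← pd_mul smoothExt_cotθ h3 hy, ← pd_sub h23 c3 hy]
    rfl
  have dP : ∀ y ∈ exterior M, ∀ a, pd a (fun y => 1 / 2 * sphLap F y + F y) y
      = 1 / 2 * (pd a (pd 2 (pd 2 F)) y
      + ((if a = 2 then -2 * cotθ y * cscSq y else 0) * pd 3 (pd 3 F) y
        + cscSq y * pd a (pd 3 (pd 3 F)) y)
      + ((if a = 2 then -cscSq y else 0) * pd 2 F y + cotθ y * pd a (pd 2 F) y)) + pd a F y := by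
    intro y hy a
    rw [pd_add ((SmoothExt.const _).mul (smoothExt_sphLap hF)) hF hy,
      pd_mul (.const _) (smoothExt_sphLap hF) hy, pd_const,
      pd_congr (g := fun y => pd 2 (pd 2 F) y + cscSq y * pd 3 (pd 3 F) y + cotθ y * pd 2 F y)
        (fun z hz => sphLap_eq hz) hy, pd_add (h22.add c1) c2 hy, pd_add h22 c1 hy,
      pd_mul smoothExt_cscSq h33 hy, pd_mul smoothExt_cotθ h2 hy, pd_cotθ hy, pd_cscSq hy]
    ring
  have e23 : ∀ y ∈ exterior M, pd 3 (pd 2 F) y = pd 2 (pd 3 F) y := fun y hy => pd_comm hF hy 3 2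
  constructor
  · intro y hy
    rw [dN y hy, dC y hy, dP y hy, pd_comm h3 hy 3 2, tracefreeHess]
    simp only [if_true, Fin.reduceEq, if_false]
    linear_combination pd 2 F y * cscSq_eq hy
  · intro y hy
    rw [dN y hy, dC y hy, dP y hy, pd_comm h2 hy 3 2, pd_congr e23 hy, e23 y hy, hessθφ,
      ← cotθ]
    simp only [if_true, Fin.reduceEq, if_false]
    linear_combination pd 3 F y * cscSq_eq hy

namespace ClosedTensor

variable {h : ClosedTensor}

theorem Smooth.smoothExt_toTensor (hh : h.Smooth M) (a b : Fin 4) :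
    SmoothExt M (h.toTensor a b) := by
  obtain ⟨h00, h01, h11, H0, H1, H, H2⟩ := hh
  have s2 : SmoothExt M (fun y => 1 / 2 * Real.sin (y 2) ^ 2) :=
    (SmoothExt.const (1 / 2)).mul (ContDiffOn.pow smoothExt_sin 2)
  have e22 := (H.smoothExt.add (smoothExt_hessθθ H2.smoothExt)).sub
    ((SmoothExt.const (1 / 2)).mul (smoothExt_sphLap H2.smoothExt))
  have e33 := ((smoothExt_sinSq.mul H.smoothExt).add (smoothExt_hessφφ H2.smoothExt)).sub
    (s2.mul (smoothExt_sphLap H2.smoothExt))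
  have e23 := smoothExt_hessθφ H2.smoothExt
  fin_cases a <;> fin_cases b <;>
    first | exact h00.smoothExt | exact h01.smoothExt | exact h11.smoothExt |
      exact H0.smoothExt.pd 2 | exact H0.smoothExt.pd 3 | exact H1.smoothExt.pd 2 |
      exact H1.smoothExt.pd 3 | exact e22 | exact e33 | exact e23

theorem toTensor_eq_blockTensor (hg : h.InChandrasekharGauge M) (hx : x ∈ exterior M)
    (a b : Fin 4) :
    h.toTensor a b x = blockTensor h.h00.pull h.h11.pull h.H.pull (tracefreeHess h.H2.pull)
      (hessθφ h.H2.pull) a b x := by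
  have g01 : h.h01.pull x = 0 := (hg.1 _ hx.1).1
  have g0 : ∀ a, pd a h.H0.pull x = 0 := pd_eq_zero_of_eqOn (fun y hy => (hg.1 _ hy.1).2.1) hx
  have g1 : ∀ a, pd a h.H1.pull x = 0 := pd_eq_zero_of_eqOn (fun y hy => (hg.1 _ hy.1).2.2) hx
  have e22 : h.H.pull x + hessθθ h.H2.pull x - (1 / 2) * sphLap h.H2.pull x
      = h.H.pull x + tracefreeHess h.H2.pull x := by
    rw [sphLap_eq hx, hessθθ, tracefreeHess]; ring
  have e33 : Real.sin (x 2) ^ 2 * h.H.pull x + hessφφ h.H2.pull x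
      - (1 / 2) * Real.sin (x 2) ^ 2 * sphLap h.H2.pull x
      = sinSq x * (h.H.pull x - tracefreeHess h.H2.pull x) := by
    have hs := (sin_pos_of_mem hx).ne'
    rw [sphLap_eq hx, hessφφ, tracefreeHess, sinSq, cotθ, cscSq]
    field_simp
    ring
  fin_cases a <;> fin_cases b <;>
    first | rfl | exact g01 | exact g0 _ | exact g1 _ | exact e22 | exact e33

end ClosedTensor

theorem ClosedCovector.Smooth.smoothExt_toCovector {X : ClosedCovector} (hX : X.Smooth M)
    (a : Fin 4) : SmoothExt M (X.toCovector a) := by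
  obtain ⟨G0, G1, G2⟩ := hX
  fin_cases a
  · exact G0.smoothExt
  · exact G1.smoothExt
  · exact G2.smoothExt.pd 2
  · exact G2.smoothExt.pd 3

end

noncomputable section

/-! ### Consequences of the constraint equations for a normalization -/

/-- The part `½ Δ̊H₂ + H₂` of the constraint operator `𝓛`. -/
def ClosedTensor.anisotropy (h : ClosedTensor) (y : Fin 4 → ℝ) : ℝ :=
  1 / 2 * sphLap h.H2.pull y + h.H2.pull y

variable {M : ℝ} {x : Fin 4 → ℝ} {I : Set ℝ} {k h : ClosedTensor} {X : ClosedCovector}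

theorem ClosedTensor.constraint_eq (h : ClosedTensor) :
    h.constraint M = angularConstraint M h.h11.pull h.H.pull h.anisotropy := rfl

theorem update_t_mem_exterior (hx : x ∈ exterior M) (t : ℝ) :
    Function.update x 0 t ∈ exterior M := by
  simpa [exterior] using hx

theorem update_r_mem_exterior (hx : x ∈ exterior M) {r : ℝ} (hr : 2 * M < r) :
    Function.update x 1 r ∈ exterior M := by
  have := hx.2
  simpa [exterior, hr] using this

/-- A normalization satisfies the constraint equations, which are invariant under subtraction of a
deformation tensor. -/
theorem IsNormalization.constraintsAt (hM : 0 < M) (hk : k.Smooth M)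
    (hsol : SolvesLinearizedEinstein M k.toTensor) (hn : IsNormalization M I k X h)
    (hx : x ∈ exterior M) :
    ConstraintsAt M (blockTensor h.h00.pull h.h11.pull h.H.pull (tracefreeHess h.H2.pull)
      (hessθφ h.H2.pull)) x :=
  ConstraintsAt.sub hM hk.smoothExt_toTensor
    (smoothExt_deformation hM hn.smooth_covector.smoothExt_toCovector)
    (fun y hy a b => by rw [← ClosedTensor.toTensor_eq_blockTensor hn.gauge hy, hn.eq_sub y hy])
    hx (hsol.constraintsAt hM hx)
    (constraintsAt_deformation hM hn.smooth_covector.smoothExt_toCovector hx)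

theorem IsNormalization.sphereDivergence (hn : IsNormalization M I k X h) :
    SphereDivergence M (tracefreeHess h.H2.pull) (hessθφ h.H2.pull) h.anisotropy :=
  sphereDivergence_tracefreeHess hn.smooth.2.2.2.2.2.2.smoothExt

theorem IsNormalization.smoothExt_anisotropy (hn : IsNormalization M I k X h) :
    SmoothExt M h.anisotropy :=
  ((SmoothExt.const _).mul (smoothExt_sphLap hn.smooth.2.2.2.2.2.2.smoothExt)).add
    hn.smooth.2.2.2.2.2.2.smoothExt

theorem IsNormalization.smoothExt_constraint (hn : IsNormalization M I k X h) :
    SmoothExt M (h.constraint M) :=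
  smoothExt_angularConstraint hn.smooth.2.2.1.smoothExt hn.smooth.2.2.2.2.2.1.smoothExt
    hn.smoothExt_anisotropy

/-- The gradient of `𝓛(h)` along the spheres is conserved by the momentum constraints, hence
vanishes. -/
theorem IsNormalization.pd_constraint_eq_zero (hM : 0 < M) (hk : k.Smooth M)
    (hsol : SolvesLinearizedEinstein M k.toTensor) (hn : IsNormalization M I k X h) :
    ∀ y ∈ exterior M, pd 2 (h.constraint M) y = 0 ∧ pd 3 (h.constraint M) y = 0 := by
  have hA := hn.smooth.1.smoothExt
  have hB := hn.smooth.2.2.1.smoothExt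
  have hH := hn.smooth.2.2.2.2.2.1.smoothExt
  have hF := hn.smooth.2.2.2.2.2.2.smoothExt
  have hN := smoothExt_tracefreeHess hF
  have hC := smoothExt_hessθφ hF
  have hP := hn.smoothExt_anisotropy
  have hL := hn.smoothExt_constraint
  have hdiv := hn.sphereDivergence
  have hslice := hn.gauge.2
  have conserved : ∀ y ∈ exterior M, pd 0 (pd 2 (h.constraint M)) y = 0 ∧
      pd 0 (pd 3 (h.constraint M)) y = 0 := by
    intro y hy
    have hr : 1 / (2 * y 1 ^ 2) ≠ 0 := by
      have := r_pos hM hy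
      positivity
    have c := hn.constraintsAt hM hk hsol hy
    have c2 := c.polar
    have c3 := c.azimuthal
    rw [linRicci_zero_two_blockTensor hM hA hB hH hN hC hP hdiv hy] at c2
    rw [linRicci_zero_three_blockTensor hM hA hB hH hN hC hP hdiv hy] at c3
    exact ⟨(mul_eq_zero.1 c2).resolve_left hr, (mul_eq_zero.1 c3).resolve_left hr⟩
  intro y hy
  have hy0 := update_t_mem_exterior hy 0
  constructor
  · rw [← eq_update_of_pd_eq_zero (a := 0) (hL.pd 2) (fun s hs => (conserved _ hs).1) hy hy0]
    exact pd_eq_zero_on_slice hL hslice (by decide) hy0 (by simp)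
  · rw [← eq_update_of_pd_eq_zero (a := 0) (hL.pd 3) (fun s hs => (conserved _ hs).2) hy hy0]
    exact pd_eq_zero_on_slice hL hslice (by decide) hy0 (by simp)

/-- `𝓛(h)` is constant on each sphere. -/
theorem IsNormalization.constraint_const (hM : 0 < M) (hk : k.Smooth M)
    (hsol : SolvesLinearizedEinstein M k.toTensor) (hn : IsNormalization M I k X h) {t r : ℝ}
    (hr : 2 * M < r) : ∃ C : ℝ, ∀ θ ∈ Set.Ioo 0 Real.pi, ∀ φ : ℝ,
      h.constraint M ![t, r, θ, φ] = C := by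
  have hL := hn.smoothExt_constraint
  have hpd := hn.pd_constraint_eq_zero hM hk hsol
  refine ⟨h.constraint M ![t, r, Real.pi / 2, 0], fun θ hθ φ => ?_⟩
  have m1 : ![t, r, θ, φ] ∈ exterior M := ⟨hr, hθ.1, hθ.2⟩
  have m2 : ![t, r, θ, (0 : ℝ)] ∈ exterior M := ⟨hr, hθ.1, hθ.2⟩
  have m3 : ![t, r, Real.pi / 2, (0 : ℝ)] ∈ exterior M :=
    ⟨hr, by simp [Real.pi_pos], by simp [Real.pi_pos]⟩
  have u1 : Function.update ![t, r, θ, φ] 3 0 = ![t, r, θ, (0 : ℝ)] := by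
    ext i; fin_cases i <;> simp
  have u2 : Function.update ![t, r, θ, (0 : ℝ)] 2 (Real.pi / 2)
      = ![t, r, Real.pi / 2, (0 : ℝ)] := by
    ext i; fin_cases i <;> simp
  have e1 := eq_update_of_pd_eq_zero (a := 3) hL (fun s hs => (hpd _ hs).2) m1
    (s := 0) (by rwa [u1])
  have e2 := eq_update_of_pd_eq_zero (a := 2) hL (fun s hs => (hpd _ hs).1) m2
    (s := Real.pi / 2) (by rwa [u2])
  rw [u1] at e1
  rw [u2] at e2
  rw [← e1, ← e2]

/-- Outside its radial support on the initial slice, `h₁₁` and the spherical trace `H` vanish. -/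
theorem IsNormalization.eq_zero_of_notMem (hn : IsNormalization M I k X h) (hx : x ∈ exterior M)
    (hx0 : x 0 = 0) (hxI : x 1 ∉ I) : h.h11.pull x = 0 ∧ h.H.pull x = 0 := by
  have hz := hn.support x hx hx0 hxI
  have hs := (sin_pos_of_mem hx).ne'
  have h22 : h.H.pull x + tracefreeHess h.H2.pull x = 0 := by
    simpa [ClosedTensor.toTensor_eq_blockTensor hn.gauge hx, blockTensor] using hz 2 2
  have h33 : sinSq x * (h.H.pull x - tracefreeHess h.H2.pull x) = 0 := by
    simpa only [ClosedTensor.toTensor_eq_blockTensor hn.gauge hx, blockTensor, Matrix.cons_val]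
      using hz 3 3
  have h33' := (mul_eq_zero.1 h33).resolve_left (pow_ne_zero 2 hs)
  exact ⟨hz 1 1, by linarith⟩

/-- The radial constraint quantity vanishes: by the momentum constraint it is independent of `t`, by
the Hamiltonian constraint and `𝓛(h) = 0` it is independent of `r` on the initial slice, and there
it vanishes at radii outside of the support. -/
theorem IsNormalization.radialConstraint_eq_zero (hM : 0 < M) (hk : k.Smooth M)
    (hsol : SolvesLinearizedEinstein M k.toTensor) (hn : IsNormalization M I k X h) {ρ : ℝ}
    (hρ : 2 * M < ρ) (hI : ∀ᶠ s in nhds ρ, s ∉ I) (hx : x ∈ exterior M) :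
    radialConstraint M h.h11.pull h.H.pull x = 0 := by
  have hA := hn.smooth.1.smoothExt
  have hB := hn.smooth.2.2.1.smoothExt
  have hH := hn.smooth.2.2.2.2.2.1.smoothExt
  have hF := hn.smooth.2.2.2.2.2.2.smoothExt
  have hN := smoothExt_tracefreeHess hF
  have hC := smoothExt_hessθφ hF
  have hP := hn.smoothExt_anisotropy
  have hL := hn.smoothExt_constraint
  have hdiv := hn.sphereDivergence
  have hslice := hn.gauge.2
  have hW := smoothExt_radialConstraint hM hB hH
  have ht : ∀ y ∈ exterior M, pd 0 (radialConstraint M h.h11.pull h.H.pull) y = 0 := by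
    intro y hy
    have hr : 2 / (y 1 * (y 1 - 2 * M)) ≠ 0 := by
      have := r_pos hM hy
      have := D_pos hy
      positivity
    have c := (hn.constraintsAt hM hk hsol hy).radial
    rw [linRicci_zero_one_blockTensor hM hA hB hH hN hC hy] at c
    exact (mul_eq_zero.1 c).resolve_left hr
  have hrad : ∀ y ∈ exterior M, y 0 = 0 →
      pd 1 (radialConstraint M h.h11.pull h.H.pull) y = 0 := by
    intro y hy hy0
    have hr : 4 / y 1 ^ 2 ≠ 0 := by
      have := r_pos hM hy
      positivity
    have c := (hn.constraintsAt hM hk hsol hy).hamiltonian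
    have z : ∀ a : Fin 4, a ≠ 0 → ∀ z ∈ exterior M, z 0 = 0 → pd a (h.constraint M) z = 0 :=
      fun a ha z hz hz0 => pd_eq_zero_on_slice hL hslice ha hz hz0
    rw [hamiltonian_blockTensor hM hA hB hH hN hC hP hdiv hy, ← h.constraint_eq,
      z 2 (by decide) y hy hy0,
      pd_eq_zero_on_slice (hL.pd 2) (z 2 (by decide)) (by decide) hy hy0,
      pd_eq_zero_on_slice (hL.pd 3) (z 3 (by decide)) (by decide) hy hy0] at c
    simp only [mul_zero, add_zero] at c
    exact (mul_eq_zero.1 c).resolve_left hr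
  have hx0 := update_t_mem_exterior hx 0
  have hx1 := update_r_mem_exterior hx0 hρ
  rw [← eq_update_of_pd_eq_zero (a := 0) hW (fun s hs => ht _ hs) hx hx0,
    ← eq_update_of_pd_eq_zero (a := 1) hW (fun s hs => hrad _ hs (by simp)) hx0 hx1]
  set z := Function.update (Function.update x 0 0) 1 ρ with hz
  have hz1 : z 1 = ρ := by simp [hz]
  have hz0 : z 0 = 0 := by simp [hz]
  obtain ⟨zB, zH⟩ := hn.eq_zero_of_notMem hx1 hz0 (by rw [hz1]; exact hI.self_of_nhds)
  have zH' : pd 1 h.H.pull z = 0 := by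
    apply pd_eq_of_hasDerivAt hH hx1
    refine (hasDerivAt_const _ (0 : ℝ)).congr_of_eventuallyEq ?_
    rw [hz1]
    filter_upwards [hI, lt_mem_nhds hρ] with s hs hs'
    exact (hn.eq_zero_of_notMem (update_r_mem_exterior hx1 hs') (by simpa using hz0)
      (by simpa using hs)).2
  rw [radialConstraint, zB, zH, zH']
  ring

end

noncomputable section

/-! ### Integrals depending on a parameter -/

theorem continuousOn_intervalIntegral {X : Type*} [TopologicalSpace X] {s : Set X}
    {F : X → ℝ → ℝ} (hF : ContinuousOn (fun p : X × ℝ => F p.1 p.2) (s ×ˢ Set.univ)) (a b : ℝ) :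
    ContinuousOn (fun x => ∫ φ in a..b, F x φ) s := by
  rw [continuousOn_iff_continuous_domRestrict]
  refine intervalIntegral.continuous_parametric_intervalIntegral_of_continuous'
    (f := fun x : s => F x) ?_ a b
  exact hF.comp_continuous (f := fun p : s × ℝ => ((p.1 : X), p.2)) (by fun_prop)
    fun p => ⟨p.1.2, trivial⟩

/-- Differentiation under an integral over a compact interval. -/
theorem hasDerivAt_intervalIntegral_of_continuousOn {s : Set ℝ} (hs : IsOpen s) {F F' : ℝ → ℝ → ℝ}
    (hF : ∀ x ∈ s, Continuous (F x))
    (hF' : ContinuousOn (fun p : ℝ × ℝ => F' p.1 p.2) (s ×ˢ Set.univ))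
    (hd : ∀ x ∈ s, ∀ φ, HasDerivAt (fun y => F y φ) (F' x φ) x) (a b : ℝ) {x : ℝ} (hx : x ∈ s) :
    HasDerivAt (fun y => ∫ φ in a..b, F y φ) (∫ φ in a..b, F' x φ) x := by
  obtain ⟨ε, hε, hball⟩ := Metric.isOpen_iff.1 hs x hx
  have hsub : Metric.closedBall x (ε / 2) ⊆ s :=
    (Metric.closedBall_subset_ball (by linarith)).trans hball
  obtain ⟨C, hC⟩ := ((isCompact_closedBall x (ε / 2)).prod (isCompact_uIcc (a := a) (b := b))
    ).exists_bound_of_continuousOn (hF'.mono (Set.prod_mono hsub (Set.subset_univ _)))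
  refine (intervalIntegral.hasDerivAt_integral_of_dominated_loc_of_deriv_le
    (F := F) (F' := F') (bound := fun _ => C) (Metric.ball_mem_nhds x (half_pos hε)) ?_ ?_ ?_ ?_ ?_
    ?_).2
  · filter_upwards [hs.mem_nhds hx] with y hy
    exact (hF y hy).aestronglyMeasurable
  · exact (hF x hx).intervalIntegrable _ _
  · refine Continuous.aestronglyMeasurable ?_
    exact hF'.comp_continuous (f := fun φ : ℝ => (x, φ)) (by fun_prop) fun φ => ⟨hx, trivial⟩
  · exact Filter.Eventually.of_forall fun φ hφ y hy =>
      hC (y, φ) ⟨Metric.ball_subset_closedBall hy, Set.uIoc_subset_uIcc hφ⟩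
  · exact intervalIntegrable_const
  · exact Filter.Eventually.of_forall fun φ _ y hy =>
      hd y (hsub (Metric.ball_subset_closedBall hy)) φ

/-! ### Green's identity on the sphere -/

/-- The `θ` derivative of a function of the spherical coordinates `(θ, φ)`. -/
def dθ (f : ℝ × ℝ → ℝ) (p : ℝ × ℝ) : ℝ := fderiv ℝ f p (1, 0)

/-- The `φ` derivative of a function of the spherical coordinates `(θ, φ)`. -/
def dφ (f : ℝ × ℝ → ℝ) (p : ℝ × ℝ) : ℝ := fderiv ℝ f p (0, 1)

/-- The Laplacian of the unit sphere in spherical coordinates. -/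
def lapS (f : ℝ × ℝ → ℝ) (p : ℝ × ℝ) : ℝ :=
  dθ (dθ f) p + dφ (dφ f) p / Real.sin p.1 ^ 2 + Real.cos p.1 / Real.sin p.1 * dθ f p

variable {f k : ℝ × ℝ → ℝ}

theorem contDiff_dθ (hf : ContDiff ℝ ∞ f) : ContDiff ℝ ∞ (dθ f) :=
  (hf.fderiv_right (m := ∞) (by simp)).clm_apply contDiff_const

theorem contDiff_dφ (hf : ContDiff ℝ ∞ f) : ContDiff ℝ ∞ (dφ f) :=
  (hf.fderiv_right (m := ∞) (by simp)).clm_apply contDiff_const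

theorem hasDerivAt_dθ (hf : ContDiff ℝ ∞ f) (θ φ : ℝ) :
    HasDerivAt (fun τ => f (τ, φ)) (dθ f (θ, φ)) θ :=
  ((hf.differentiable (by simp)) (θ, φ)).hasFDerivAt.comp_hasDerivAt θ
    ((hasDerivAt_id θ).prodMk (hasDerivAt_const θ φ))

theorem hasDerivAt_dφ (hf : ContDiff ℝ ∞ f) (θ φ : ℝ) :
    HasDerivAt (fun τ => f (θ, τ)) (dφ f (θ, φ)) φ :=
  ((hf.differentiable (by simp)) (θ, φ)).hasFDerivAt.comp_hasDerivAt φ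
    ((hasDerivAt_const φ θ).prodMk (hasDerivAt_id φ))

theorem dφ_periodic (hf : ContDiff ℝ ∞ f) (hp : ∀ θ φ, f (θ, φ + 2 * Real.pi) = f (θ, φ))
    (θ φ : ℝ) : dφ f (θ, φ + 2 * Real.pi) = dφ f (θ, φ) := by
  have h1 := (hasDerivAt_dφ hf θ (φ + 2 * Real.pi)).comp_add_const φ (2 * Real.pi)
  simp only [hp] at h1
  exact h1.unique (hasDerivAt_dφ hf θ φ)

/-- Green's identity on the unit sphere. The boundary terms at the poles vanish because of the
factor `sin θ`, those in `φ` by periodicity. -/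
theorem integral_green (hf : ContDiff ℝ ∞ f) (hk : ContDiff ℝ ∞ k)
    (hfp : ∀ θ φ, f (θ, φ + 2 * Real.pi) = f (θ, φ))
    (hkp : ∀ θ φ, k (θ, φ + 2 * Real.pi) = k (θ, φ)) {Φ : ℝ → ℝ → ℝ}
    (hΦ : ∀ θ ∈ Set.Ioo 0 Real.pi, ∀ φ, Φ θ φ
      = (lapS f (θ, φ) * k (θ, φ) - f (θ, φ) * lapS k (θ, φ)) * Real.sin θ) :
    ∫ θ in (0 : ℝ)..Real.pi, ∫ φ in (0 : ℝ)..(2 * Real.pi), Φ θ φ = 0 := by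
  have f1 := contDiff_dθ hf
  have f2 := contDiff_dφ hf
  have f11 := contDiff_dθ f1
  have f22 := contDiff_dφ f2
  have k1 := contDiff_dθ hk
  have k2 := contDiff_dφ hk
  have k11 := contDiff_dθ k1
  have k22 := contDiff_dφ k2
  -- the flux through a circle of latitude and its derivative
  set G : ℝ → ℝ → ℝ := fun θ φ =>
    Real.sin θ * (k (θ, φ) * dθ f (θ, φ) - f (θ, φ) * dθ k (θ, φ)) with hG
  set G' : ℝ → ℝ → ℝ := fun θ φ =>
    Real.cos θ * (k (θ, φ) * dθ f (θ, φ) - f (θ, φ) * dθ k (θ, φ))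
      + Real.sin θ * (k (θ, φ) * dθ (dθ f) (θ, φ) - f (θ, φ) * dθ (dθ k) (θ, φ)) with hG'
  have cG' : Continuous fun p : ℝ × ℝ => G' p.1 p.2 := by
    have := hf.continuous
    have := hk.continuous
    have := f1.continuous
    have := k1.continuous
    have := f11.continuous
    have := k11.continuous
    simp only [hG']
    fun_prop
  have cG : ∀ θ, Continuous (G θ) := by
    have := hf.continuous
    have := hk.continuous
    have := f1.continuous
    have := k1.continuous
    simp only [hG]
    fun_prop
  have dG : ∀ θ φ, HasDerivAt (fun τ => G τ φ) (G' θ φ) θ := fun θ φ =>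
    ((Real.hasDerivAt_sin θ).mul (((hasDerivAt_dθ hk θ φ).mul (hasDerivAt_dθ f1 θ φ)).sub
      ((hasDerivAt_dθ hf θ φ).mul (hasDerivAt_dθ k1 θ φ)))).congr_deriv (by
        simp only [hG', Pi.sub_apply, Pi.mul_apply]; ring)
  have hA : ∀ θ, HasDerivAt (fun τ => ∫ φ in (0 : ℝ)..(2 * Real.pi), G τ φ)
      (∫ φ in (0 : ℝ)..(2 * Real.pi), G' θ φ) θ := fun θ =>
    hasDerivAt_intervalIntegral_of_continuousOn isOpen_univ (fun τ _ => cG τ) cG'.continuousOn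
      (fun τ _ φ => dG τ φ) _ _ (Set.mem_univ θ)
  have cA : Continuous fun θ => ∫ φ in (0 : ℝ)..(2 * Real.pi), G' θ φ :=
    intervalIntegral.continuous_parametric_intervalIntegral_of_continuous' cG' _ _
  have key : ∀ θ ∈ Set.Ioo 0 Real.pi, ∫ φ in (0 : ℝ)..(2 * Real.pi), Φ θ φ
      = ∫ φ in (0 : ℝ)..(2 * Real.pi), G' θ φ := by
    intro θ hθ
    have hs : Real.sin θ ≠ 0 := (Real.sin_pos_of_pos_of_lt_pi hθ.1 hθ.2).ne'
    -- the difference of the integrands is a `φ` derivative of a periodic function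
    set Q' : ℝ → ℝ := fun φ =>
      (k (θ, φ) * dφ (dφ f) (θ, φ) - f (θ, φ) * dφ (dφ k) (θ, φ)) / Real.sin θ with hQ'
    have dQ : ∀ φ, HasDerivAt (fun τ => (k (θ, τ) * dφ f (θ, τ) - f (θ, τ) * dφ k (θ, τ))
        / Real.sin θ) (Q' φ) φ := fun φ =>
      ((((hasDerivAt_dφ hk θ φ).mul (hasDerivAt_dφ f2 θ φ)).sub
        ((hasDerivAt_dφ hf θ φ).mul (hasDerivAt_dφ k2 θ φ))).div_const _).congr_deriv (by
          simp only [hQ']; ring)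
    have cQ : Continuous Q' := by
      have := hf.continuous
      have := hk.continuous
      have := f22.continuous
      have := k22.continuous
      simp only [hQ']
      fun_prop
    have hQ0 : ∫ φ in (0 : ℝ)..(2 * Real.pi), Q' φ = 0 := by
      rw [intervalIntegral.integral_eq_sub_of_hasDerivAt (fun φ _ => dQ φ)
        (cQ.intervalIntegrable _ _)]
      have p1 := hfp θ 0
      have p2 := hkp θ 0
      have p3 := dφ_periodic hf hfp θ 0
      have p4 := dφ_periodic hk hkp θ 0
      simp only [zero_add] at p1 p2 p3 p4
      rw [p1, p2, p3, p4, sub_self]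
    have cGθ : Continuous (G' θ) := cG'.comp (Continuous.prodMk_right θ)
    have : ∀ φ, Φ θ φ = G' θ φ + Q' φ := by
      intro φ
      rw [hΦ θ hθ]
      simp only [lapS, hG', hQ']
      field_simp
      ring
    simp only [this]
    rw [intervalIntegral.integral_add (cGθ.intervalIntegrable _ _) (cQ.intervalIntegrable _ _),
      hQ0, add_zero]
  rw [intervalIntegral.integral_congr_Ioo_of_le Real.pi_pos.le key,
    intervalIntegral.integral_eq_sub_of_hasDerivAt (fun θ _ => hA θ)
      (cA.intervalIntegrable _ _)]
  simp [hG]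

end

noncomputable section

/-! ### Projection to spherical harmonics -/

/-- The restriction of a function to the sphere of given `t` and `r`, in spherical coordinates. -/
def Fld.restr (f : Fld) (t r : ℝ) (p : ℝ × ℝ) : ℝ := f ((t, r), sphPt p.1 p.2)

/-- The iterated integral in spherical coordinates. -/
def sphInt (Φ : ℝ × ℝ → ℝ) : ℝ :=
  ∫ θ in (0 : ℝ)..Real.pi, ∫ φ in (0 : ℝ)..(2 * Real.pi), Φ (θ, φ)

theorem sphInt_add {Φ Ψ : ℝ × ℝ → ℝ} (hΦ : Continuous Φ) (hΨ : Continuous Ψ) :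
    sphInt (fun p => Φ p + Ψ p) = sphInt Φ + sphInt Ψ := by
  have h : ∀ {Φ : ℝ × ℝ → ℝ}, Continuous Φ →
      Continuous fun θ => ∫ φ in (0 : ℝ)..(2 * Real.pi), Φ (θ, φ) := fun hΦ =>
    intervalIntegral.continuous_parametric_intervalIntegral_of_continuous' (by exact hΦ) _ _
  have h' : ∀ {Φ : ℝ × ℝ → ℝ}, Continuous Φ → ∀ θ, Continuous fun φ => Φ (θ, φ) := fun hΦ θ =>
    hΦ.comp (Continuous.prodMk_right θ)
  simp only [sphInt]
  rw [← intervalIntegral.integral_add ((h hΦ).intervalIntegrable _ _)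
    ((h hΨ).intervalIntegrable _ _)]
  refine intervalIntegral.integral_congr fun θ _ => ?_
  exact intervalIntegral.integral_add ((h' hΦ θ).intervalIntegrable _ _)
    ((h' hΨ θ).intervalIntegrable _ _)

theorem sphInt_const_mul (c : ℝ) (Φ : ℝ × ℝ → ℝ) : sphInt (fun p => c * Φ p) = c * sphInt Φ := by
  simp only [sphInt, intervalIntegral.integral_const_mul]

theorem sphInt_congr {Φ Ψ : ℝ × ℝ → ℝ} (h : ∀ θ ∈ Set.Ioo 0 Real.pi, ∀ φ, Φ (θ, φ) = Ψ (θ, φ)) :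
    sphInt Φ = sphInt Ψ :=
  intervalIntegral.integral_congr_Ioo_of_le Real.pi_pos.le fun θ hθ => by
    simp only [h θ hθ]

theorem sphPt_periodic (θ φ : ℝ) : sphPt θ (φ + 2 * Real.pi) = sphPt θ φ := by
  simp [sphPt]

variable {M : ℝ} {f : Fld} {Y : S2 → ℝ} {ℓ : ℕ}

theorem Fld.restr_periodic (f : Fld) (t r θ φ : ℝ) :
    f.restr t r (θ, φ + 2 * Real.pi) = f.restr t r (θ, φ) := by
  simp only [Fld.restr, sphPt_periodic]

theorem SmoothFld.contDiff_restr (hf : SmoothFld M f) (t : ℝ) {r : ℝ} (hr : 2 * M < r) :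
    ContDiff ℝ ∞ (f.restr t r) := by
  have := hf.contDiffOn_comp (E := ℝ × ℝ) (t := fun _ => t) (r := fun _ => r) (θ := Prod.fst)
    (φ := Prod.snd) contDiff_const contDiff_const contDiff_fst contDiff_snd
  rw [← contDiffOn_univ]
  exact this.mono fun _ _ => hr

theorem pd_θ_pull (hf : SmoothFld M f) {x : Fin 4 → ℝ} (hx : x ∈ exterior M) :
    pd 2 f.pull x = dθ (f.restr (x 0) (x 1)) (x 2, x 3) := by
  apply pd_eq_of_hasDerivAt hf.smoothExt hx
  simpa [Fld.pull, Fld.restr] using hasDerivAt_dθ (hf.contDiff_restr (x 0) hx.1) (x 2) (x 3)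

theorem pd_φ_pull (hf : SmoothFld M f) {x : Fin 4 → ℝ} (hx : x ∈ exterior M) :
    pd 3 f.pull x = dφ (f.restr (x 0) (x 1)) (x 2, x 3) := by
  apply pd_eq_of_hasDerivAt hf.smoothExt hx
  simpa [Fld.pull, Fld.restr] using hasDerivAt_dφ (hf.contDiff_restr (x 0) hx.1) (x 2) (x 3)

theorem sphLap_pull (hf : SmoothFld M f) {x : Fin 4 → ℝ} (hx : x ∈ exterior M) :
    sphLap f.pull x = lapS (f.restr (x 0) (x 1)) (x 2, x 3) := by
  have hc := hf.contDiff_restr (x 0) hx.1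
  have h22 : pd 2 (pd 2 f.pull) x = dθ (dθ (f.restr (x 0) (x 1))) (x 2, x 3) := by
    apply pd_eq_of_hasDerivAt (hf.smoothExt.pd 2) hx
    refine (hasDerivAt_dθ (contDiff_dθ hc) (x 2) (x 3)).congr_of_eventuallyEq ?_
    filter_upwards [eventually_update_mem_exterior hx 2] with s hs
    simpa using pd_θ_pull hf hs
  have h33 : pd 3 (pd 3 f.pull) x = dφ (dφ (f.restr (x 0) (x 1))) (x 2, x 3) := by
    apply pd_eq_of_hasDerivAt (hf.smoothExt.pd 3) hx
    refine (hasDerivAt_dφ (contDiff_dφ hc) (x 2) (x 3)).congr_of_eventuallyEq ?_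
    filter_upwards [eventually_update_mem_exterior hx 3] with s hs
    simpa using pd_φ_pull hf hs
  rw [sphLap_eq hx, h22, h33, pd_θ_pull hf hx, lapS, cscSq, cotθ]
  ring

theorem IsSphericalHarmonic.smoothFld (hY : IsSphericalHarmonic ℓ Y) :
    SmoothFld M (fun p => Y p.2) :=
  (hY.1.comp contMDiff_snd).contMDiffOn

theorem IsSphericalHarmonic.contDiff (hY : IsSphericalHarmonic ℓ Y) :
    ContDiff ℝ ∞ (fun p : ℝ × ℝ => Y (sphPt p.1 p.2)) :=
  (hY.smoothFld (M := 0)).contDiff_restr 0 (r := 1) (by norm_num)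

theorem IsSphericalHarmonic.continuous_integrand (hY : IsSphericalHarmonic ℓ Y) (c : ℝ)
    {Φ : ℝ × ℝ → ℝ} (hΦ : Continuous Φ) :
    Continuous fun p => c * (Φ p * Y (sphPt p.1 p.2) * Real.sin p.1) :=
  continuous_const.mul ((hΦ.mul hY.contDiff.continuous).mul (by fun_prop))

theorem IsSphericalHarmonic.lapS_eq (hY : IsSphericalHarmonic ℓ Y) {θ : ℝ}
    (hθ : θ ∈ Set.Ioo 0 Real.pi) (φ : ℝ) :
    lapS (fun p : ℝ × ℝ => Y (sphPt p.1 p.2)) (θ, φ) = -(ℓ * (ℓ + 1)) * Y (sphPt θ φ) := by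
  have hx : ![0, 1, θ, φ] ∈ exterior 0 := ⟨by simp, hθ.1, hθ.2⟩
  have h1 := sphLap_pull (hY.smoothFld (M := 0)) hx
  exact h1.symm.trans (hY.2 ![0, 1, θ, φ] hθ.1 hθ.2)

/-- Spherical harmonics of positive degree have mean zero. -/
theorem IsSphericalHarmonic.integral_eq_zero (hY : IsSphericalHarmonic ℓ Y) (hℓ : 0 < ℓ) :
    sphInt (fun p => Y (sphPt p.1 p.2) * Real.sin p.1) = 0 := by
  have hne : (ℓ : ℝ) * (ℓ + 1) ≠ 0 := by positivity
  have h := integral_green (f := fun _ => 1) contDiff_const hY.contDiff (fun _ _ => rfl)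
    (fun θ φ => by simp only [sphPt_periodic])
    (Φ := fun θ φ => ℓ * (ℓ + 1) * (Y (sphPt θ φ) * Real.sin θ)) (fun θ hθ φ => by
      rw [hY.lapS_eq hθ]
      have e1 : dθ (fun _ => 1) = fun _ => 0 := by funext p; simp [dθ]
      have e2 : dφ (fun _ => 1) = fun _ => 0 := by funext p; simp [dφ]
      have e3 : dφ (fun _ => 0) = fun _ => 0 := by funext p; simp [dφ]
      have e4 : dθ (fun _ => 0) = fun _ => 0 := by funext p; simp [dθ]
      simp only [lapS, e1, e2, e3, e4]
      ring)
  have h' := sphInt_const_mul (ℓ * (ℓ + 1)) (fun p => Y (sphPt p.1 p.2) * Real.sin p.1)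
  exact (mul_eq_zero.1 (h'.symm.trans h)).resolve_left hne

theorem mode_eq_sphInt (Y : S2 → ℝ) (f : Fld) (t r : ℝ) :
    mode Y f t r = sphInt (fun p => f.restr t r p * Y (sphPt p.1 p.2) * Real.sin p.1) := rfl

/-- If `½ Δ̊H₂ + H₂ - H - q B` is constant on a sphere, its projection to a spherical harmonic of
positive degree vanishes. -/
theorem mode_constraint (hY : IsSphericalHarmonic ℓ Y) (hℓ : 0 < ℓ) {F H B : Fld}
    (hF : SmoothFld M F) (hH : SmoothFld M H) (hB : SmoothFld M B) {t r : ℝ} (hr : 2 * M < r)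
    {q C : ℝ} (h : ∀ θ ∈ Set.Ioo 0 Real.pi, ∀ φ, 1 / 2 * lapS (F.restr t r) (θ, φ)
      + F.restr t r (θ, φ) - H.restr t r (θ, φ) - q * B.restr t r (θ, φ) = C) :
    (ℓ * (ℓ + 1) - 2) * mode Y F t r + 2 * mode Y H t r + 2 * q * mode Y B t r = 0 := by
  have cF := hF.contDiff_restr t hr
  have hcF := cF.continuous
  have hcH := (hH.contDiff_restr t hr).continuous
  have hcB := (hB.contDiff_restr t hr).continuous
  have hcY := hY.contDiff.continuous
  have int' : Continuous fun p : ℝ × ℝ => 2 * C * (Y (sphPt p.1 p.2) * Real.sin p.1) :=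
    continuous_const.mul (hcY.mul (by fun_prop))
  have green := integral_green cF hY.contDiff (F.restr_periodic t r)
    (fun θ φ => by simp only [sphPt_periodic])
    (Φ := fun θ φ => (ℓ * (ℓ + 1) - 2) * (F.restr t r (θ, φ) * Y (sphPt θ φ) * Real.sin θ)
      + 2 * (H.restr t r (θ, φ) * Y (sphPt θ φ) * Real.sin θ)
      + 2 * q * (B.restr t r (θ, φ) * Y (sphPt θ φ) * Real.sin θ)
      + 2 * C * (Y (sphPt θ φ) * Real.sin θ)) (fun θ hθ φ => by
      rw [hY.lapS_eq hθ]
      linear_combination (-2 * Y (sphPt θ φ) * Real.sin θ) * h θ hθ φ)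
  have split : sphInt (fun p => (ℓ * (ℓ + 1) - 2)
        * (F.restr t r p * Y (sphPt p.1 p.2) * Real.sin p.1)
      + 2 * (H.restr t r p * Y (sphPt p.1 p.2) * Real.sin p.1)
      + 2 * q * (B.restr t r p * Y (sphPt p.1 p.2) * Real.sin p.1)
      + 2 * C * (Y (sphPt p.1 p.2) * Real.sin p.1)) = 0 := green
  rw [sphInt_add (((hY.continuous_integrand _ hcF).fun_add
      (hY.continuous_integrand _ hcH)).fun_add (hY.continuous_integrand _ hcB)) int',
    sphInt_add ((hY.continuous_integrand _ hcF).fun_add (hY.continuous_integrand _ hcH))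
      (hY.continuous_integrand _ hcB),
    sphInt_add (hY.continuous_integrand _ hcF) (hY.continuous_integrand _ hcH),
    sphInt_const_mul, sphInt_const_mul, sphInt_const_mul,
    sphInt_const_mul, hY.integral_eq_zero hℓ] at split
  simp only [mode_eq_sphInt]
  linear_combination split

/-- The `r` derivative of a function, restricted to a sphere. -/
def Fld.drRestr (f : Fld) (t r : ℝ) (p : ℝ × ℝ) : ℝ :=
  fderiv ℝ (fun z : (ℝ × ℝ) × ℝ => f ((t, z.1.1), sphPt z.1.2 z.2)) ((r, p.1), p.2) ((1, 0), 0)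

theorem SmoothFld.contDiffOn_restr₃ (hf : SmoothFld M f) (t : ℝ) :
    ContDiffOn ℝ ∞ (fun z : (ℝ × ℝ) × ℝ => f ((t, z.1.1), sphPt z.1.2 z.2))
      {z | 2 * M < z.1.1} :=
  hf.contDiffOn_comp contDiff_const (contDiff_fst.comp contDiff_fst)
    (contDiff_snd.comp contDiff_fst) contDiff_snd

theorem isOpen_restr₃ (M : ℝ) : IsOpen {z : (ℝ × ℝ) × ℝ | 2 * M < z.1.1} :=
  isOpen_lt continuous_const (by fun_prop)

theorem SmoothFld.continuousOn_drRestr (hf : SmoothFld M f) (t : ℝ) :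
    ContinuousOn (fun z : (ℝ × ℝ) × ℝ => f.drRestr t z.1.1 (z.1.2, z.2)) {z | 2 * M < z.1.1} :=
  ((hf.contDiffOn_restr₃ t).continuousOn_fderiv_of_isOpen (isOpen_restr₃ M) (by simp)).clm_apply
    continuousOn_const

theorem SmoothFld.hasDerivAt_restr (hf : SmoothFld M f) (t : ℝ) {r : ℝ} (hr : 2 * M < r)
    (p : ℝ × ℝ) : HasDerivAt (fun s => f.restr t s p) (f.drRestr t r p) r := by
  have h1 : DifferentiableAt ℝ (fun z : (ℝ × ℝ) × ℝ => f ((t, z.1.1), sphPt z.1.2 z.2))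
      ((r, p.1), p.2) :=
    ((hf.contDiffOn_restr₃ t).contDiffAt ((isOpen_restr₃ M).mem_nhds hr)).differentiableAt (by simp)
  exact h1.hasFDerivAt.comp_hasDerivAt r
    (((hasDerivAt_id r).prodMk (hasDerivAt_const r p.1)).prodMk (hasDerivAt_const r p.2))

theorem hasDerivAt_mode (hY : IsSphericalHarmonic ℓ Y) (hf : SmoothFld M f) (t : ℝ) {r : ℝ}
    (hr : 2 * M < r) :
    HasDerivAt (fun s => mode Y f t s)
      (sphInt (fun p => f.drRestr t r p * Y (sphPt p.1 p.2) * Real.sin p.1)) r := by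
  have hcY := hY.contDiff.continuous
  have hd : ContinuousOn (fun z : (ℝ × ℝ) × ℝ => f.drRestr t z.1.1 (z.1.2, z.2)
      * Y (sphPt z.1.2 z.2) * Real.sin z.1.2) ((Set.Ioi (2 * M) ×ˢ Set.univ) ×ˢ Set.univ) := by
    have hY' : Continuous fun z : (ℝ × ℝ) × ℝ => Y (sphPt z.1.2 z.2) :=
      hcY.comp (f := fun z : (ℝ × ℝ) × ℝ => (z.1.2, z.2)) (by fun_prop)
    exact (((hf.continuousOn_drRestr t).mono fun z hz => hz.1.1).mul hY'.continuousOn).mul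
      (by fun_prop)
  refine hasDerivAt_intervalIntegral_of_continuousOn (s := Set.Ioi (2 * M)) isOpen_Ioi
    (F := fun s θ => ∫ φ in (0 : ℝ)..(2 * Real.pi), f.restr t s (θ, φ) * Y (sphPt θ φ) * Real.sin θ)
    (F' := fun s θ => ∫ φ in (0 : ℝ)..(2 * Real.pi),
      f.drRestr t s (θ, φ) * Y (sphPt θ φ) * Real.sin θ) ?_ ?_ ?_ 0 Real.pi hr
  · intro s hs
    have := (hf.contDiff_restr t hs).continuous
    exact intervalIntegral.continuous_parametric_intervalIntegral_of_continuous'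
      (f := fun θ φ => f.restr t s (θ, φ) * Y (sphPt θ φ) * Real.sin θ)
      ((this.mul hcY).mul (by fun_prop)) _ _
  · exact continuousOn_intervalIntegral (X := ℝ × ℝ)
      (F := fun z φ => f.drRestr t z.1 (z.2, φ) * Y (sphPt z.2 φ) * Real.sin z.2) hd _ _
  · intro s hs θ
    refine hasDerivAt_intervalIntegral_of_continuousOn (s := Set.Ioi (2 * M)) isOpen_Ioi
      (F := fun s φ => f.restr t s (θ, φ) * Y (sphPt θ φ) * Real.sin θ)
      (F' := fun s φ => f.drRestr t s (θ, φ) * Y (sphPt θ φ) * Real.sin θ) ?_ ?_ ?_ _ _ hs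
    · intro s hs
      have := (hf.contDiff_restr t hs).continuous
      exact ((this.comp (Continuous.prodMk_right θ)).mul
        (hcY.comp (Continuous.prodMk_right θ))).mul continuous_const
    · exact hd.comp (f := fun z : ℝ × ℝ => ((z.1, θ), z.2)) (by fun_prop)
        fun z hz => ⟨⟨hz.1, trivial⟩, trivial⟩
    · intro s hs φ
      exact ((hf.hasDerivAt_restr t hs (θ, φ)).mul_const _).mul_const _

theorem pd_r_pull (hf : SmoothFld M f) {x : Fin 4 → ℝ} (hx : x ∈ exterior M) :
    pd 1 f.pull x = f.drRestr (x 0) (x 1) (x 2, x 3) := by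
  apply pd_eq_of_hasDerivAt hf.smoothExt hx
  simpa [Fld.pull, Fld.restr] using hf.hasDerivAt_restr (x 0) hx.1 (x 2, x 3)

/-- The Friedman equations hold for a normalization whose initial support leaves out a neighbourhood
of some radius. -/
theorem IsNormalization.friedmanEquations (hM : 0 < M) {I : Set ℝ} {k h : ClosedTensor}
    {X : ClosedCovector} (hk : k.Smooth M) (hsol : SolvesLinearizedEinstein M k.toTensor)
    (hn : IsNormalization M I k X h) {ρ : ℝ} (hρ : 2 * M < ρ) (hI : ∀ᶠ s in nhds ρ, s ∉ I)
    (hℓ : 0 < ℓ) (hY : IsSphericalHarmonic ℓ Y) : FriedmanEquations M h ℓ Y := by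
  intro t r hr
  have hB := hn.smooth.2.2.1
  have hH := hn.smooth.2.2.2.2.2.1
  have hF := hn.smooth.2.2.2.2.2.2
  have hr0 : r ≠ 0 := by linarith
  have hD0 : r - 2 * M ≠ 0 := by linarith
  have mem : ∀ θ ∈ Set.Ioo 0 Real.pi, ∀ φ : ℝ, ![t, r, θ, φ] ∈ exterior M :=
    fun θ hθ φ => ⟨hr, hθ.1, hθ.2⟩
  obtain ⟨C, hC⟩ := hn.constraint_const hM hk hsol (t := t) hr
  have e1 : (ℓ * (ℓ + 1) - 2) * mode Y h.H2 t r + 2 * mode Y h.H t r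
      + 2 * (r ^ 2 - 2 * M * r) * mode Y h.h11 t r = 0 := by
    refine mode_constraint hY hℓ hF hH hB hr (C := C) fun θ hθ φ => ?_
    rw [← hC θ hθ φ]
    have := sphLap_pull hF (mem θ hθ φ)
    simp only [Matrix.cons_val] at this
    rw [← this]
    rfl
  have first : friedmanL M h Y t r + (1 / 2) * ((ℓ : ℝ) + 2) * ((ℓ : ℝ) - 1) * friedmanV h Y t r
      + friedmanT h Y t r = 0 := by
    simp only [friedmanL, friedmanV, friedmanT]
    field_simp
    linear_combination e1
  refine ⟨first, ?_⟩
  have hcY := hY.contDiff.continuous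
  have hcH := (hH.contDiff_restr t hr).continuous
  have hcB := (hB.contDiff_restr t hr).continuous
  have e2 : sphInt (fun p => h.H.drRestr t r p * Y (sphPt p.1 p.2) * Real.sin p.1)
      = (r - 2 * M) * mode Y h.h11 t r + (r - M) / (r * (r - 2 * M)) * mode Y h.H t r := by
    rw [mode_eq_sphInt, mode_eq_sphInt, ← sphInt_const_mul, ← sphInt_const_mul,
      ← sphInt_add (hY.continuous_integrand _ hcB) (hY.continuous_integrand _ hcH)]
    refine sphInt_congr fun θ hθ φ => ?_
    have h1 := hn.radialConstraint_eq_zero hM hk hsol hρ hI (mem θ hθ φ)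
    rw [radialConstraint, pd_r_pull hH (mem θ hθ φ)] at h1
    simp only [Matrix.cons_val, Fld.pull] at h1
    have h2 : h.H.drRestr t r (θ, φ) = (r - 2 * M) * h.h11.restr t r (θ, φ)
        + (r - M) / (r * (r - 2 * M)) * h.H.restr t r (θ, φ) := by
      simp only [Fld.restr]
      field_simp at h1 ⊢
      linear_combination -h1
    rw [h2]
    ring
  have d1 := (((hasDerivAt_id' r).pow 2).const_mul 2).inv (by simp [hr0])
  have d2 := d1.mul (hasDerivAt_mode hY hH t hr)
  rw [e2] at d2
  have hT : (fun s => friedmanT h Y t s) = fun s => (2 * s ^ 2)⁻¹ * mode Y h.H t s := by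
    funext s; rw [friedmanT, one_div]
  rw [hT]
  refine d2.congr_deriv ?_
  simp only [friedmanL, friedmanV, friedmanT, Pi.pow_apply, Pi.inv_apply] at first ⊢
  field_simp at first ⊢
  push_cast
  linear_combination r * (r - 2 * M) * first

end

end Schwarzschild

theorem mainTheorem7 (M r₀ R₀ : ℝ) (hM : 0 < M) (hr₀ : 2 * M < r₀) (hR₀ : r₀ < R₀)
    (k : Schwarzschild.ClosedTensor) (hk : k.Smooth M)
    (hsol : Schwarzschild.SolvesLinearizedEinstein M k.toTensor)
    (hsupp : Schwarzschild.SupportedInitially M k.toTensor (Set.Ioo r₀ R₀))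
    (ℓ : ℕ) (hℓ : 2 ≤ ℓ) (Y : Schwarzschild.S2 → ℝ)
    (hY : Schwarzschild.IsSphericalHarmonic ℓ Y) :
    (∀ (X : Schwarzschild.ClosedCovector) (h : Schwarzschild.ClosedTensor),
        Schwarzschild.IsNormalizationI M r₀ k X h →
          Schwarzschild.FriedmanEquations M h ℓ Y) ∧
      (∀ (X : Schwarzschild.ClosedCovector) (h : Schwarzschild.ClosedTensor),
        Schwarzschild.IsNormalizationII M R₀ k X h →
          Schwarzschild.FriedmanEquations M h ℓ Y) := by
  constructor
  · intro X h hn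
    refine Schwarzschild.IsNormalization.friedmanEquations hM hk hsol hn
      (ρ := (2 * M + r₀) / 2) (by linarith) ?_ (by omega) hY
    filter_upwards [gt_mem_nhds (show (2 * M + r₀) / 2 < r₀ by linarith)] with s hs
    exact not_lt.2 (le_of_lt hs)
  · intro X h hn
    refine Schwarzschild.IsNormalization.friedmanEquations hM hk hsol hn
      (ρ := R₀ + 1) (by linarith) ?_ (by omega) hY
    filter_upwards [lt_mem_nhds (show R₀ < R₀ + 1 by linarith)] with s hs
    exact not_lt.2 (le_of_lt hs)
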